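/- Let $q=r^2$ be a square prime power (so $\sqrt q=r$), let $n\ge 6$, and let $V=\mathbb F_q^n$ carry a nondegenerate Hermitian form with respect to $a\mapsto a^{\sqrt q}$ (the unitary space $U(n,\sqrt q)$), with polarity $\perp$. A subspace $S$ is isotropic if $S\subseteq S^\perp$; its radical is $S\cap S^\perp$. Let $\Gamma$ be the graph whose vertices are the non-isotropic points ($1$-spaces) of $V$, with $x,y$ adjacent if $x\subseteq y^\perp$; write $\Gamma(x)$ for the set of neighbours of $x$. Let $L_1,L_2$ be non-isotropic $2$-spaces such that $p=L_1\cap L_2$ is $1$-dimensional and is the radical of both $L_1$ and $L_2$, put $P=L_1+L_2$ (so $\dim P=m=3$), and assume that $P/p$ with the induced form is isomorphic to $U(2,\sqrt q)$, i.e. is a nondegenerate Hermitian space of dimension $2$. Such $L_1,L_2$ exist. Let $C_1$ be the set of points of $L_1$ not in $L_2$, let $C_2$ be the set of points of $L_2$ not in $L_1$, and let $D$ be the set of vertices not in $C_1\cup C_2$. Then: 1. For every triangle $\{x,y,z\}$ of $\Gamma$, the number $|\Gamma(x)\cap\Gamma(y)\cap\Gamma(z)|$ has the same value. 2. $\{C_1,C_2\}$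 is a switching set of $\Gamma$: $C_1$ and $C_2$ are disjoint with $|C_1|=|C_2|$; the subgraphs induced on $C_1$, $C_2$ and $C_1\cup C_2$ are regular, those on $C_1$ and $C_2$ of the same degree; and each $x\in D$ satisfies $|\Gamma(x)\cap C_1|=|\Gamma(x)\cap C_2|$ or $\Gamma(x)\cap(C_1\cup C_2)\in\{C_1,C_2\}$. Let $\overline\Gamma$ be the graph obtained by switching: for each $x\in D$ with $\Gamma(x)\cap(C_1\cup C_2)=C_i$ one replaces this neighbourhood of $x$ in $C_1\cup C_2$ by $C_j$, where $\{i,j\}=\{1,2\}$, and all other adjacencies are kept. 3. There are three vertices $x,y,z$, none of them in $P$, which form a triangle both in $\Gamma$ and in $\overline\Gamma$ and satisfy $|\overline\Gamma(x)\cap\overline\Gamma(y)\cap\overline\Gamma(z)|=|\Gamma(x)\cap\Gamma(y)\cap\Gamma(z)|-1$. 4. $\overline\Gamma$ is not isomorphic to $\Gamma$. 5. If $q=4$, then $\Gamma$ and $\overline\Gamma$ are strongly regular with the same parameters, and the complements of both graphs are strongly regular with parameters, where $\epsilon=(-1)^n$, $$v=\tfrac{2^{n-1}(2^n-\epsilon)}{3},\quad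 k=(2^{n-1}+\epsilon)(2^{n-2}-\epsilon),\quad \lambda=3\cdot 2^{2n-5}-\epsilon 2^{n-2}-2,\quad \mu=3\cdot 2^{n-3}(2^{n-2}-\epsilon).$$ -/

import Mathlib

open scoped LinearAlgebra.Projectivization

namespace PolarityGraph

section Switching

variable {W : Type*}

/-- `{C₁, C₂}` satisfies the hypotheses of Wang--Qiu--Hu switching in the graph `G`, the third
part of the vertex partition being `D = (C₁ ∪ C₂)ᶜ`. -/
structure IsSwitchingSet (G : SimpleGraph W) (C₁ C₂ : Set W) : Prop where
  disjoint : Disjoint C₁ C₂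
  card_eq : C₁.ncard = C₂.ncard
  /-- the graphs induced on `C₁` and on `C₂` are regular, of the same degree -/
  regular_each : ∃ k : ℕ, (∀ x ∈ C₁, (G.neighborSet x ∩ C₁).ncard = k) ∧
    (∀ x ∈ C₂, (G.neighborSet x ∩ C₂).ncard = k)
  /-- the graph induced on `C₁ ∪ C₂` is regular -/
  regular_union : ∃ k : ℕ, ∀ x ∈ C₁ ∪ C₂, (G.neighborSet x ∩ (C₁ ∪ C₂)).ncard = k
  outside : ∀ x ∉ C₁ ∪ C₂,
    (G.neighborSet x ∩ C₁).ncard = (G.neighborSet x ∩ C₂).ncard ∨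
    G.neighborSet x ∩ (C₁ ∪ C₂) = C₁ ∨ G.neighborSet x ∩ (C₁ ∪ C₂) = C₂

open Classical in
/-- The neighbours in `C₁ ∪ C₂` of a vertex `x ∉ C₁ ∪ C₂` after switching. -/
noncomputable def switchedNeighbors (G : SimpleGraph W) (C₁ C₂ : Set W) (x : W) : Set W :=
  if G.neighborSet x ∩ (C₁ ∪ C₂) = C₂ then C₁
  else if G.neighborSet x ∩ (C₁ ∪ C₂) = C₁ then C₂
  else G.neighborSet x ∩ (C₁ ∪ C₂)

/-- The graph obtained from `G` by switching with respect to `{C₁, C₂}`: only adjacencies between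
`C₁ ∪ C₂` and its complement are modified. -/
noncomputable def switch (G : SimpleGraph W) (C₁ C₂ : Set W) : SimpleGraph W where
  Adj x y :=
    (x ∉ C₁ ∪ C₂ ∧ y ∈ C₁ ∪ C₂ ∧ y ∈ switchedNeighbors G C₁ C₂ x) ∨
    (x ∈ C₁ ∪ C₂ ∧ y ∉ C₁ ∪ C₂ ∧ x ∈ switchedNeighbors G C₁ C₂ y) ∨
    ((x ∈ C₁ ∪ C₂ ↔ y ∈ C₁ ∪ C₂) ∧ G.Adj x y)
  symm := ⟨fun x y hxy => by
    rcases hxy with ⟨h₁, h₂, h₃⟩ | ⟨h₁, h₂, h₃⟩ | ⟨h₁, h₂⟩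
    · exact Or.inr (Or.inl ⟨h₂, h₁, h₃⟩)
    · exact Or.inl ⟨h₂, h₁, h₃⟩
    · exact Or.inr (Or.inr ⟨h₁.symm, h₂.symm⟩)⟩
  loopless := ⟨fun x hx => by
    rcases hx with ⟨h₁, h₂, _⟩ | ⟨h₁, h₂, _⟩ | ⟨_, h₂⟩
    · exact h₁ h₂
    · exact h₂ h₁
    · exact G.irrefl h₂⟩

/-- The set of common neighbours of three vertices. -/
def commonNeighbors₃ (G : SimpleGraph W) (x y z : W) : Set W :=
  G.neighborSet x ∩ G.neighborSet y ∩ G.neighborSet z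

/-- `{x, y, z}` is a triangle of `G`. -/
def IsTriangle (G : SimpleGraph W) (x y z : W) : Prop :=
  G.Adj x y ∧ G.Adj x z ∧ G.Adj y z

open Classical in
/-- `G` is a finite strongly regular graph with parameters `(v, k, l, m)`; this is
`SimpleGraph.IsSRGWith` without a chosen enumeration of the vertices. -/
def IsSRG (G : SimpleGraph W) (v k l m : ℕ) : Prop :=
  ∃ _ : Fintype W, G.IsSRGWith v k l m

end Switching

section Polarity

variable {K : Type*} [Field K] {σ : K →+* K} {V : Type*} [AddCommGroup V] [Module K V]

/-- `h` is a nondegenerate `σ`-Hermitian form: `σ (h x y) = h y x`, and no nonzero vector is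
orthogonal to the whole space. -/
def IsNondegHermitian (h : V →ₛₗ[σ] V →ₗ[K] K) : Prop :=
  h.IsSymm ∧ h.Nondegenerate

/-- A subspace `S` is isotropic if `S ⊆ S^⊥`. -/
def IsIsotropic (h : V →ₛₗ[σ] V →ₗ[K] K) (S : Submodule K V) : Prop :=
  S ≤ S.orthogonalBilin h

/-- The radical `S ∩ S^⊥` of a subspace `S`. -/
def radical (h : V →ₛₗ[σ] V →ₗ[K] K) (S : Submodule K V) : Submodule K V :=
  S ⊓ S.orthogonalBilin h

/-- The non-isotropic points (`1`-spaces) of the space. -/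
abbrev NonIsotropicPoint (h : V →ₛₗ[σ] V →ₗ[K] K) : Type _ :=
  {x : ℙ K V // ¬ IsIsotropic h x.submodule}

/-- The orthogonality graph on non-isotropic points: `x` and `y` are adjacent if `x ⊆ y^⊥`. -/
def graph (h : V →ₛₗ[σ] V →ₗ[K] K) (hs : h.IsSymm) : SimpleGraph (NonIsotropicPoint h) where
  Adj x y := x.1.submodule ≤ y.1.submodule.orthogonalBilin h
  symm := ⟨fun _ _ hxy b hb _ ha => hs.isRefl _ _ (hxy ha b hb)⟩
  loopless := ⟨fun x hx => x.2 hx⟩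

/-- The non-isotropic points contained in `S` and not in `T`. -/
def pointsDiff (h : V →ₛₗ[σ] V →ₗ[K] K) (S T : Submodule K V) : Set (NonIsotropicPoint h) :=
  {x | x.1.submodule ≤ S ∧ ¬ x.1.submodule ≤ T}

/-- `L₁` and `L₂` are non-isotropic `(m-1)`-spaces such that `L₁ ∩ L₂` has dimension `m - 2` and is
the radical of `L₁` and of `L₂`. -/
structure IsSwitchingPair (h : V →ₛₗ[σ] V →ₗ[K] K) (m : ℕ) (L₁ L₂ : Submodule K V) : Prop where
  nonisotropic_left : ¬ IsIsotropic h L₁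
  nonisotropic_right : ¬ IsIsotropic h L₂
  finrank_left : Module.finrank K L₁ + 1 = m
  finrank_right : Module.finrank K L₂ + 1 = m
  finrank_inf : Module.finrank K (L₁ ⊓ L₂ : Submodule K V) + 2 = m
  radical_left : L₁ ⊓ L₂ = radical h L₁
  radical_right : L₁ ⊓ L₂ = radical h L₂

/-- The quotient `P / p`, with the form induced by `h`, is a nondegenerate Hermitian space of
dimension `k`, i.e. a unitary space of type `U(k, √q)`. -/
def IsUnitaryQuotient (h : V →ₛₗ[σ] V →ₗ[K] K) (P p : Submodule K V) (k : ℕ) : Prop :=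
  p ≤ P ∧ Module.finrank K (P ⧸ p.submoduleOf P) = k ∧
    ∃ hq : (P ⧸ p.submoduleOf P) →ₛₗ[σ] (P ⧸ p.submoduleOf P) →ₗ[K] K,
      (∀ u v : P, hq (Submodule.Quotient.mk u) (Submodule.Quotient.mk v) = h u v) ∧
      IsNondegHermitian hq

/-- The graph obtained from the orthogonality graph by switching with respect to
`C₁ = L₁ \ L₂` and `C₂ = L₂ \ L₁`. -/
noncomputable def switchedGraph (h : V →ₛₗ[σ] V →ₗ[K] K) (hs : h.IsSymm)
    (L₁ L₂ : Submodule K V) : SimpleGraph (NonIsotropicPoint h) :=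
  switch (graph h hs) (pointsDiff h L₁ L₂) (pointsDiff h L₂ L₁)

end Polarity

end PolarityGraph

/-!
The vertices are handled through spanning vectors. A subspace `U` with radical of dimension `d` and
`dim U = d + j` has `q ^ d * Z j` isotropic vectors, where `Z 0 = 1` and
`Z (j + 1) = (r + 1) q ^ j - r Z j`: a vector of `U` is `y + t u` with `u` non-isotropic and
`y ⊥ u`, and the norm `t ↦ t ^ (r + 1)` takes each nonzero value of the subfield of order `r` exactly
`r + 1` times (`card_isotropic`). Hence the number of non-isotropic points of `U` depends only on `d` and
`j`. The common neighbours of a triangle are the points of a nondegenerate subspace of codimension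
`3`, so their number is constant.

A switching pair is given by a frame `e, u, w`: `e` spans the radical, `L₁ = ⟨e, u⟩`, `L₂ = ⟨e, w⟩`,
and the Gram determinant of `u, w` does not vanish (`IsSwitchingFrame`). The points of `Cᵢ` are
`⟨u + a e⟩`, respectively `⟨w + a e⟩`, so a point not orthogonal to `e` is adjacent to exactly one
point of each `Cᵢ`, and a point orthogonal to `e` to all or none. This makes `{C₁, C₂}` a switching
set.

For the triangle, `x` is chosen orthogonal to `e` and `u` but not to `w`, so that it is switched
from `C₁` to `C₂`, while `y` and `z` are not orthogonal to `e`; they have the same neighbour in `C₁`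
and different ones in `C₂`. The common neighbour in `C₁` is lost and none is gained
(`ncard_commonNeighbors₃_switch`). As the number of common neighbours of a triangle is constant in
the original graph, the graphs are not isomorphic.

Switching conjugates the adjacency matrix `A` by the reflection in the vector `1_{C₁} - 1_{C₂}`
(`adjMatrix_switch_eq`). This preserves the equation `A ^ 2 = k I + l A + m (J - I - A)`, so the
switched graph is strongly regular with the same parameters whenever the original one is. For
`q = 4` all nonzero norms are `1`, so two distinct nonadjacent points span a line with a radical of
dimension `1`, and the point count gives the parameters (`isSRG_graph_four`).
-/

open scoped LinearAlgebra.Projectivization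

namespace PolarityGraph

/-! ### Norm and trace of the quadratic extension -/

section FiniteField

variable {K : Type*} [Field K] [Finite K] {r : ℕ} {σ : K →+* K}

theorem two_le_of_card (hK : Nat.card K = r ^ 2) : 2 ≤ r := by
  have h1 : 1 < Nat.card K := Finite.one_lt_card
  rw [hK] at h1
  by_contra hr
  interval_cases r <;> simp at h1

theorem conj_conj (hK : Nat.card K = r ^ 2) (hσ : ∀ a, σ a = a ^ r) (a : K) : σ (σ a) = a := by
  have := Fintype.ofFinite K
  rw [hσ, hσ, ← pow_mul, ← pow_two, ← hK, Nat.card_eq_fintype_card, FiniteField.pow_card]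

theorem card_units_eq (hK : Nat.card K = r ^ 2) : Nat.card Kˣ = (r + 1) * (r - 1) := by
  have h2 := two_le_of_card hK
  rw [Nat.card_units, hK]
  have := Nat.sq_sub_sq r 1
  simpa using this

/-- The norm `t ↦ t ^ (r + 1)` maps onto the nonzero elements of the subfield of order `r`: its
image lies in the group of `(r - 1)`-st roots of unity, which has the same order. -/
theorem exists_norm_eq (hK : Nat.card K = r ^ 2) (hσ : ∀ a, σ a = a ^ r) {b : K} (hb : σ b = b)
    (hb0 : b ≠ 0) : ∃ t : K, t ≠ 0 ∧ σ t * t = b := by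
  have h2 := two_le_of_card hK
  have hc := card_units_eq hK
  have hrange : (powMonoidHom (r + 1) : Kˣ →* Kˣ).range =
      (powMonoidHom (r - 1) : Kˣ →* Kˣ).ker := by
    apply Subgroup.eq_of_le_of_card_ge
    · rintro _ ⟨t, rfl⟩
      rw [MonoidHom.mem_ker, powMonoidHom_apply, powMonoidHom_apply, ← pow_mul, ← hc,
        pow_card_eq_one']
    · rw [IsCyclic.card_powMonoidHom_ker, IsCyclic.card_powMonoidHom_range, hc,
        Nat.gcd_mul_right_left, Nat.gcd_mul_left_left, Nat.mul_div_cancel_left _ (by omega)]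
  have hmem : Units.mk0 b hb0 ∈ (powMonoidHom (r - 1) : Kˣ →* Kˣ).ker := by
    rw [MonoidHom.mem_ker, powMonoidHom_apply]
    ext
    have h3 : b ^ (r - 1) * b = 1 * b := by
      rw [← pow_succ, Nat.sub_add_cancel (by omega), ← hσ, hb, one_mul]
    simpa using mul_right_cancel₀ hb0 h3
  rw [← hrange] at hmem
  obtain ⟨t, ht⟩ := hmem
  refine ⟨t, t.ne_zero, ?_⟩
  rw [hσ, ← pow_succ]
  simpa using congrArg Units.val ht

/-- The fibres of the norm over its nonzero values are the cosets of its kernel, which has order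
`r + 1`. -/
theorem card_norm_fiber (hK : Nat.card K = r ^ 2) (hσ : ∀ a, σ a = a ^ r) {b : K} (hb : σ b = b)
    (hb0 : b ≠ 0) : Nat.card {t : K // σ t * t = b} = r + 1 := by
  have h2 := two_le_of_card hK
  have hc := card_units_eq hK
  obtain ⟨t₀, ht₀, ht⟩ := exists_norm_eq hK hσ hb hb0
  have hker : Nat.card (powMonoidHom (r + 1) : Kˣ →* Kˣ).ker = r + 1 := by
    rw [IsCyclic.card_powMonoidHom_ker, hc, Nat.gcd_mul_right_left]
  rw [← hker]
  have key : ∀ t : K, σ t * t = t ^ (r + 1) := fun t => by rw [hσ, ← pow_succ]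
  rw [key] at ht
  symm
  refine Nat.card_congr (Equiv.ofBijective
    (fun s : (powMonoidHom (r + 1) : Kˣ →* Kˣ).ker => ⟨(s.1 : K) * t₀, ?_⟩) ⟨?_, ?_⟩)
  · have hs := s.2
    rw [MonoidHom.mem_ker, powMonoidHom_apply] at hs
    have hs' : (s.1 : K) ^ (r + 1) = 1 := by simpa using congrArg Units.val hs
    rw [key, mul_pow, hs', one_mul, ht]
  · intro s s' hss
    have := mul_right_cancel₀ ht₀ (congrArg Subtype.val hss)
    exact Subtype.ext (Units.ext this)
  · rintro ⟨t, htb⟩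
    rw [key] at htb
    have ht0 : t ≠ 0 := by
      rintro rfl
      exact hb0 (by rw [← htb, zero_pow (by omega)])
    refine ⟨⟨Units.mk0 (t / t₀) (div_ne_zero ht0 ht₀), ?_⟩, ?_⟩
    · rw [MonoidHom.mem_ker, powMonoidHom_apply]
      ext
      simp only [Units.val_pow_eq_pow_val, Units.val_mk0, Units.val_one]
      rw [div_pow, ht, htb, div_self hb0]
    · exact Subtype.ext (div_mul_cancel₀ t ht₀)

/-- The trace `a ↦ a + σ a` takes the value `1`: as a polynomial of degree `r` it does not vanish
on the whole field, and its values are fixed by `σ`. -/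
theorem exists_trace_eq_one (hK : Nat.card K = r ^ 2) (hσ : ∀ a, σ a = a ^ r) :
    ∃ b : K, b + σ b = 1 := by
  have h2 := two_le_of_card hK
  obtain ⟨a, ha⟩ : ∃ a : K, a + σ a ≠ 0 := by
    by_contra! hall
    have := Fintype.ofFinite K
    set p : Polynomial K := Polynomial.X ^ r + Polynomial.X with hp
    have hdeg : p.natDegree = r := by
      rw [hp]; compute_degree
      · rw [if_neg (by omega)]; simp
      · omega
    have h0 : p = 0 := by
      apply Polynomial.eq_zero_of_natDegree_lt_card_of_eval_eq_zero p (f := id)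
        Function.injective_id
      · intro a
        simp only [hp, id, Polynomial.eval_add, Polynomial.eval_pow, Polynomial.eval_X]
        rw [← hσ, add_comm]; exact hall a
      · rw [hdeg, ← Nat.card_eq_fintype_card, hK]; nlinarith
    rw [h0] at hdeg
    simp at hdeg
    omega
  refine ⟨a / (a + σ a), ?_⟩
  rw [map_div₀, map_add, conj_conj hK hσ, add_comm (σ a) a, ← add_div, div_self ha]

end FiniteField

/-! ### Hermitian forms and orthogonal splitting -/

section Hermitian

variable {K : Type*} [Field K] {r : ℕ} {σ : K →+* K}
  {V : Type*} [AddCommGroup V] [Module K V] {h : V →ₛₗ[σ] V →ₗ[K] K}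

theorem mem_radical (hs : h.IsSymm) {U : Submodule K V} {v : V} :
    v ∈ radical h U ↔ v ∈ U ∧ ∀ y ∈ U, h v y = 0 := by
  rw [radical, Submodule.mem_inf]
  exact and_congr_right fun _ => forall₂_congr fun y _ => hs.isRefl.eq_iff

theorem radical_eq_bot_iff (hs : h.IsSymm) {U : Submodule K V} :
    radical h U = ⊥ ↔ ∀ v ∈ U, (∀ y ∈ U, h v y = 0) → v = 0 := by
  rw [Submodule.eq_bot_iff]
  simp only [mem_radical hs, and_imp]

theorem radical_top_eq_bot (hh : IsNondegHermitian h) : radical h ⊤ = ⊥ :=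
  (radical_eq_bot_iff hh.1).2 fun v _ hv => hh.2.1 v fun y => hv y trivial

/-- For a Hermitian form, nondegeneracy on the left suffices. -/
theorem isNondegHermitian_of_left (hs : h.IsSymm) (hl : h.SeparatingLeft) :
    IsNondegHermitian h :=
  ⟨hs, hl, fun y hy => hl y fun x => hs.isRefl _ _ (hy x)⟩

theorem conj_self (hs : h.IsSymm) (v : V) : σ (h v v) = h v v := hs.eq v v

/-- Polarization: a Hermitian form whose diagonal vanishes on a subspace vanishes there. -/
theorem eq_zero_of_diag_eq_zero (hs : h.IsSymm) {β : K} (hβ : β + σ β = 1) {U : Submodule K V}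
    (hU : ∀ v ∈ U, h v v = 0) {x y : V} (hx : x ∈ U) (hy : y ∈ U) : h x y = 0 := by
  by_contra hxy
  have h1 := hU _ (U.add_mem hx (U.smul_mem (β / h x y) hy))
  have h2 : σ (h x y) ≠ 0 := (map_ne_zero σ).2 hxy
  simp only [map_add, LinearMap.add_apply, map_smulₛₗ, LinearMap.smul_apply,
    smul_eq_mul, hU x hx, hU y hy, ← hs.eq x y, map_div₀, RingHom.id_apply, mul_zero,
    add_zero, zero_add] at h1
  rw [div_mul_cancel₀ _ hxy, div_mul_cancel₀ _ h2] at h1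
  have : β + σ β = 0 := by linear_combination h1
  rw [hβ] at this
  exact one_ne_zero this

theorem mem_inf_ker {U : Submodule K V} {u v : V} :
    v ∈ U ⊓ LinearMap.ker (h u) ↔ v ∈ U ∧ h u v = 0 := by
  rw [Submodule.mem_inf, LinearMap.mem_ker]

/-- A functional not vanishing on `U` cuts out a hyperplane of `U`. -/
theorem finrank_inf_ker [FiniteDimensional K V] {U : Submodule K V} {φ : V →ₗ[K] K} {y : V}
    (hy : y ∈ U) (hφ : φ y ≠ 0) :
    Module.finrank K (U ⊓ LinearMap.ker φ : Submodule K V) + 1 = Module.finrank K U := by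
  have h1 := LinearMap.finrank_range_add_finrank_ker (φ.domRestrict U)
  have h2 : LinearMap.range (φ.domRestrict U) = ⊤ := by
    apply LinearMap.range_eq_top.2
    apply LinearMap.surjective
    intro h0
    exact hφ (by simpa using LinearMap.congr_fun h0 ⟨y, hy⟩)
  have h3 : Module.finrank K (LinearMap.ker (φ.domRestrict U)) =
      Module.finrank K (U ⊓ LinearMap.ker φ : Submodule K V) := by
    rw [LinearMap.domRestrict, LinearMap.ker_comp, ← Submodule.map_comap_subtype,
      Submodule.finrank_map_subtype_eq]
  rw [h2, finrank_top, Module.finrank_self] at h1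
  omega

/-- The orthogonal complement in `U` of a non-isotropic vector of `U` has the same radical as
`U`. -/
theorem radical_inf_ker (hs : h.IsSymm) {U : Submodule K V} {u : V} (hu : u ∈ U)
    (huu : h u u ≠ 0) : radical h (U ⊓ LinearMap.ker (h u)) = radical h U := by
  ext v
  rw [mem_radical hs, mem_radical hs, mem_inf_ker]
  constructor
  · rintro ⟨⟨hv, huv⟩, hy⟩
    refine ⟨hv, fun y hyU => ?_⟩
    have h1 := hy (y - (h u y / h u u) • u) (mem_inf_ker.2 ⟨?_, ?_⟩)
    · rwa [map_sub, map_smul, hs.isRefl _ _ huv, smul_zero, sub_zero] at h1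
    · exact U.sub_mem hyU (U.smul_mem _ hu)
    · rw [map_sub, map_smul, smul_eq_mul, div_mul_cancel₀ _ huu, sub_self]
  · rintro ⟨hv, hy⟩
    exact ⟨⟨hv, hs.isRefl _ _ (hy u hu)⟩, fun y hyU => hy y hyU.1⟩

/-- If `e` is a nonzero isotropic vector of a nondegenerate subspace `U`, the radical of `e^⊥ ∩ U`
is spanned by `e`. -/
theorem radical_inf_ker_isotropic (hs : h.IsSymm) (hinv : ∀ a, σ (σ a) = a) {U : Submodule K V}
    (hU : radical h U = ⊥) {e : V} (he : e ∈ U) (he0 : e ≠ 0) (hee : h e e = 0) :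
    radical h (U ⊓ LinearMap.ker (h e)) = K ∙ e := by
  obtain ⟨g, hg, heg⟩ : ∃ g ∈ U, h e g ≠ 0 := by
    by_contra! hall
    exact he0 ((radical_eq_bot_iff hs).1 hU e he hall)
  ext v
  rw [mem_radical hs, mem_inf_ker, Submodule.mem_span_singleton]
  constructor
  · rintro ⟨⟨hv, hev⟩, hy⟩
    refine ⟨σ (h v g / h e g), ?_⟩
    symm
    rw [← sub_eq_zero]
    refine (radical_eq_bot_iff hs).1 hU _ (U.sub_mem hv (U.smul_mem _ he)) fun y hyU => ?_
    have h1 := hy (y - (h e y / h e g) • g) (mem_inf_ker.2 ⟨?_, ?_⟩)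
    · rw [map_sub, map_smul, smul_eq_mul] at h1
      rw [map_sub, LinearMap.sub_apply, map_smulₛₗ, LinearMap.smul_apply, smul_eq_mul, hinv]
      field_simp at h1 ⊢
      linear_combination h1
    · exact U.sub_mem hyU (U.smul_mem _ hg)
    · rw [map_sub, map_smul, smul_eq_mul, div_mul_cancel₀ _ heg, sub_self]
  · rintro ⟨a, rfl⟩
    refine ⟨⟨U.smul_mem _ he, by rw [map_smul, hee, smul_zero]⟩, fun y hy => ?_⟩
    rw [map_smulₛₗ, LinearMap.smul_apply, (mem_inf_ker.1 hy).2, smul_zero]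

theorem exists_diag_ne_zero (hs : h.IsSymm) {β : K} (hβ : β + σ β = 1) {U : Submodule K V}
    (hU : radical h U < U) : ∃ u ∈ U, h u u ≠ 0 := by
  by_contra! hall
  exact hU.not_ge fun v hv => (mem_radical hs).2
    ⟨hv, fun y hy => eq_zero_of_diag_eq_zero hs hβ hall hv hy⟩

theorem exists_diag_ne_zero_of_pos (hs : h.IsSymm) {β : K} (hβ : β + σ β = 1) {U : Submodule K V}
    (hU : radical h U = ⊥) (hpos : 0 < Module.finrank K U) : ∃ u ∈ U, h u u ≠ 0 := by
  apply exists_diag_ne_zero hs hβ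
  rw [hU, bot_lt_iff_ne_bot]
  rintro rfl
  simp at hpos

/-- A nonzero isotropic vector of a nondegenerate subspace is part of a hyperbolic pair. -/
theorem exists_hyperbolic_partner (hs : h.IsSymm) {β : K}
    (hβ : β + σ β = 1) {U : Submodule K V} (hU : radical h U = ⊥) {e : V} (he : e ∈ U)
    (he0 : e ≠ 0) (hee : h e e = 0) : ∃ f ∈ U, h f f = 0 ∧ h e f = 1 := by
  obtain ⟨g, hg, heg⟩ : ∃ g ∈ U, h e g ≠ 0 := by
    by_contra! hall
    exact he0 ((radical_eq_bot_iff hs).1 hU e he hall)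
  obtain ⟨f₀, hf₀, hef₀⟩ : ∃ f₀ ∈ U, h e f₀ = 1 :=
    ⟨(h e g)⁻¹ • g, U.smul_mem _ hg, by rw [map_smul, smul_eq_mul, inv_mul_cancel₀ heg]⟩
  have hfe₀ : h f₀ e = 1 := by rw [← hs.eq, hef₀, map_one]
  refine ⟨f₀ - (β * h f₀ f₀) • e, U.sub_mem hf₀ (U.smul_mem _ he), ?_, ?_⟩
  · simp only [map_sub, LinearMap.sub_apply, map_smulₛₗ, LinearMap.smul_apply, smul_eq_mul, hee,
      hef₀, hfe₀, map_mul, conj_self hs, RingHom.id_apply]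
    linear_combination (-h f₀ f₀) * hβ
  · rw [map_sub, map_smul, hee, hef₀, smul_zero, sub_zero]

/-- Splitting off a hyperbolic pair. -/
theorem radical_inf_ker_hyperbolic (hs : h.IsSymm) {U : Submodule K V}
    (hU : radical h U = ⊥) {e f : V} (he : e ∈ U) (hf : f ∈ U) (hee : h e e = 0) (hff : h f f = 0)
    (hef : h e f = 1) : radical h (U ⊓ LinearMap.ker (h e) ⊓ LinearMap.ker (h f)) = ⊥ := by
  have hfe : h f e = 1 := by rw [← hs.eq, hef, map_one]
  rw [radical_eq_bot_iff hs]
  intro v hv hy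
  obtain ⟨hv, hfv⟩ := mem_inf_ker.1 hv
  obtain ⟨hv, hev⟩ := mem_inf_ker.1 hv
  refine (radical_eq_bot_iff hs).1 hU v hv fun y hyU => ?_
  have h1 := hy (y - h e y • f - h f y • e)
    (mem_inf_ker.2 ⟨mem_inf_ker.2 ⟨U.sub_mem (U.sub_mem hyU (U.smul_mem _ hf)) (U.smul_mem _ he),
      ?_⟩, ?_⟩)
  · simpa [hs.isRefl _ _ hev, hs.isRefl _ _ hfv] using h1
  · simp [hee, hef]
  · simp [hfe, hff]

theorem finrank_inf_ker_hyperbolic [FiniteDimensional K V] (hs : h.IsSymm) {U : Submodule K V}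
    {e f : V} (he : e ∈ U) (hf : f ∈ U) (hee : h e e = 0) (hef : h e f = 1) :
    Module.finrank K (U ⊓ LinearMap.ker (h e) ⊓ LinearMap.ker (h f) : Submodule K V) + 2 =
      Module.finrank K U := by
  have hfe : h f e = 1 := by rw [← hs.eq, hef, map_one]
  have h1 := finrank_inf_ker (φ := h e) hf (by rw [hef]; exact one_ne_zero)
  have h2 := finrank_inf_ker (U := U ⊓ LinearMap.ker (h e)) (φ := h f) (mem_inf_ker.2 ⟨he, hee⟩)
    (by rw [hfe]; exact one_ne_zero)
  omega

/-- Dimension `2` suffices for a nonzero isotropic vector `t u + w`: take `u ⊥ w` and solve a norm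
equation for `t`. -/
theorem exists_isotropic [Finite K] [FiniteDimensional K V] (hK : Nat.card K = r ^ 2)
    (hσ : ∀ a, σ a = a ^ r) (hs : h.IsSymm) {U : Submodule K V} (hU : radical h U = ⊥)
    (hdim : 2 ≤ Module.finrank K U) : ∃ e ∈ U, e ≠ 0 ∧ h e e = 0 := by
  obtain ⟨β, hβ⟩ := exists_trace_eq_one hK hσ
  obtain ⟨u, hu, huu⟩ := exists_diag_ne_zero_of_pos hs hβ hU (by omega)
  have hd := finrank_inf_ker (φ := h u) hu huu
  obtain ⟨w, hw, hww⟩ := exists_diag_ne_zero_of_pos hs hβ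
    ((radical_inf_ker hs hu huu).trans hU) (by omega)
  obtain ⟨hw, huw⟩ := mem_inf_ker.1 hw
  obtain ⟨t, ht0, ht⟩ := exists_norm_eq hK hσ (b := -h w w / h u u)
    (by rw [map_div₀, map_neg, conj_self hs, conj_self hs]) (div_ne_zero (neg_ne_zero.2 hww) huu)
  refine ⟨t • u + w, U.add_mem (U.smul_mem _ hu) hw, ?_, ?_⟩
  · intro h0
    have h1 : h u (t • u + w) = 0 := by rw [h0, map_zero]
    rw [map_add, map_smul, huw, add_zero] at h1
    exact (mul_ne_zero ht0 huu) h1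
  · simp only [map_add, LinearMap.add_apply, map_smulₛₗ, LinearMap.smul_apply, smul_eq_mul, huw,
      hs.isRefl _ _ huw, RingHom.id_apply]
    field_simp at ht
    linear_combination ht

end Hermitian

/-! ### Counting isotropic vectors -/

section Counting

variable {K : Type*} [Field K] [Finite K] {r : ℕ} {σ : K →+* K}
  {V : Type*} [AddCommGroup V] [Module K V] [FiniteDimensional K V] {h : V →ₛₗ[σ] V →ₗ[K] K}

/-- The number of vectors `v` with `h v v = 0` in a nondegenerate Hermitian space of dimension `m`
over the field of order `r ^ 2`. -/
def isotropicCount (r : ℕ) : ℕ → ℤ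
  | 0 => 1
  | m + 1 => (r + 1) * (r ^ 2) ^ m - r * isotropicCount r m

theorem two_mul_isotropicCount_two (m : ℕ) :
    2 * isotropicCount 2 m = 4 ^ m + (-1) ^ m * 2 ^ m := by
  induction m with
  | zero => simp [isotropicCount]
  | succ m ih =>
    rw [isotropicCount, pow_succ, pow_succ, pow_succ]
    push_cast
    linear_combination (-2) * ih

open Classical in
/-- Splitting off a non-isotropic vector `u`: the vector `y + t • u` with `y ⊥ u` is isotropic for
one `t` if `y` is isotropic, and for `r + 1` values of `t` otherwise. -/
theorem card_isotropic_step (hK : Nat.card K = r ^ 2) (hσ : ∀ a, σ a = a ^ r) (hs : h.IsSymm)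
    {U : Submodule K V} {u : V} (hu : u ∈ U) (huu : h u u ≠ 0) :
    (Nat.card {v : U // h v v = 0} : ℤ) =
      (r + 1) * (r ^ 2) ^ Module.finrank K (U ⊓ LinearMap.ker (h u) : Submodule K V) -
        r * Nat.card {v : (U ⊓ LinearMap.ker (h u) : Submodule K V) // h v v = 0} := by
  set U' := U ⊓ LinearMap.ker (h u) with hU'
  have : Finite V := Module.finite_of_finite K
  have := Fintype.ofFinite U'
  have hform : ∀ (y : U') (t : K),
      h (y + t • u) (y + t • u) = h y y + σ t * t * h u u := by
    intro y t
    have huy := (mem_inf_ker.1 y.2).2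
    simp only [map_add, LinearMap.add_apply, map_smulₛₗ, LinearMap.smul_apply, smul_eq_mul,
      huy, hs.isRefl _ _ huy, RingHom.id_apply]
    ring
  have e : (Σ y : U', {t : K // σ t * t = -h y y / h u u}) ≃ {v : U // h v v = 0} := by
    refine Equiv.ofBijective (fun p => ⟨⟨p.1 + p.2.1 • u,
      U.add_mem (mem_inf_ker.1 p.1.2).1 (U.smul_mem _ hu)⟩, ?_⟩) ⟨?_, ?_⟩
    · obtain ⟨y, t, ht⟩ := p
      rw [hform, ht]
      field_simp
      ring
    · rintro ⟨y, t, ht⟩ ⟨y', t', ht'⟩ heq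
      have heq : (y : V) + t • u = y' + t' • u := congrArg (fun v => (v.1 : V)) heq
      have h1 := congrArg (h u) heq
      rw [map_add, map_add, (mem_inf_ker.1 y.2).2, (mem_inf_ker.1 y'.2).2, map_smul, map_smul,
        zero_add, zero_add] at h1
      have htt : t = t' := mul_right_cancel₀ huu h1
      subst htt
      have hyy : y = y' := Subtype.ext (add_right_cancel heq)
      subst hyy
      rfl
    · rintro ⟨⟨v, hv⟩, hvv⟩
      have hy : v - (h u v / h u u) • u ∈ U' := mem_inf_ker.2
        ⟨U.sub_mem hv (U.smul_mem _ hu), by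
          rw [map_sub, map_smul, smul_eq_mul, div_mul_cancel₀ _ huu, sub_self]⟩
      refine ⟨⟨⟨_, hy⟩, h u v / h u u, ?_⟩, ?_⟩
      · have h1 := hform ⟨_, hy⟩ (h u v / h u u)
        simp only [sub_add_cancel] at h1
        have hvv : h v v = 0 := hvv
        rw [hvv] at h1
        rw [eq_div_iff huu]
        linear_combination -h1
      · exact Subtype.ext (Subtype.ext (sub_add_cancel _ _))
  have hfib : ∀ y : U', Nat.card {t : K // σ t * t = -h y y / h u u} =
      if h y y = 0 then 1 else r + 1 := by
    intro y
    split_ifs with hy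
    · rw [hy, neg_zero, zero_div]
      have : ∀ t : K, σ t * t = 0 ↔ t = 0 := fun t => by simp
      simp [this]
    · exact card_norm_fiber hK hσ (by rw [map_div₀, map_neg, conj_self hs, conj_self hs])
        (div_ne_zero (neg_ne_zero.2 hy) huu)
  have hcard : (Fintype.card U' : ℤ) = (r ^ 2) ^ Module.finrank K U' := by
    rw [← Nat.card_eq_fintype_card, Module.natCard_eq_pow_finrank (K := K), hK]
    push_cast; rfl
  have hzero : (Nat.card {v : U' // h v v = 0} : ℤ) =
      (Finset.univ.filter fun v : U' => h v v = 0).card := by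
    rw [Nat.card_eq_fintype_card, Fintype.card_subtype]
  rw [← Nat.card_congr e, Nat.card_sigma, ← hcard, hzero]
  push_cast
  have h2 : ∀ y : U', (Nat.card {t : K // σ t * t = -h y y / h u u} : ℤ) =
      (r + 1) - r * (if h y y = 0 then 1 else 0) := by
    intro y; rw [hfib]; split_ifs <;> push_cast <;> ring
  rw [Finset.sum_congr rfl fun y _ => h2 y, Finset.sum_sub_distrib, ← Finset.mul_sum,
    Finset.sum_boole, Finset.sum_const, Finset.card_univ]
  simp only [nsmul_eq_mul]
  ring

/-- The number of isotropic vectors of a subspace depends only on its dimension and that of its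
radical: splitting off non-isotropic vectors preserves the radical, until only it is left. -/
theorem card_isotropic (hK : Nat.card K = r ^ 2) (hσ : ∀ a, σ a = a ^ r) (hs : h.IsSymm)
    (k : ℕ) (U : Submodule K V)
    (hU : Module.finrank K U = Module.finrank K (radical h U) + k) :
    (Nat.card {v : U // h v v = 0} : ℤ) =
      (r ^ 2) ^ Module.finrank K (radical h U) * isotropicCount r k := by
  induction k generalizing U with
  | zero =>
    have hle : radical h U ≤ U := inf_le_left
    have heq : radical h U = U := Submodule.eq_of_le_of_finrank_eq hle (by omega)
    have hall : ∀ v : U, h v v = 0 := fun v =>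
      ((mem_radical hs).1 (heq.symm ▸ v.2 : (v : V) ∈ radical h U)).2 v v.2
    rw [Nat.card_congr (Equiv.subtypeUnivEquiv hall), Module.natCard_eq_pow_finrank (K := K), hK,
      heq, isotropicCount]
    push_cast; ring
  | succ k ih =>
    obtain ⟨β, hβ⟩ := exists_trace_eq_one hK hσ
    have hlt : radical h U < U := lt_of_le_of_ne inf_le_left fun heq => by
      rw [heq] at hU; omega
    obtain ⟨u, hu, huu⟩ := exists_diag_ne_zero hs hβ hlt
    have hd := finrank_inf_ker (φ := h u) hu huu
    have hr := radical_inf_ker hs hu huu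
    rw [card_isotropic_step hK hσ hs hu huu, ih _ (by rw [hr]; omega), hr, isotropicCount]
    have : Module.finrank K (U ⊓ LinearMap.ker (h u) : Submodule K V) =
      Module.finrank K (radical h U) + k := by omega
    rw [this, pow_add]
    ring

end Counting

/-! ### Non-isotropic points -/

section Points

variable {K : Type*} [Field K] {r : ℕ} {σ : K →+* K}
  {V : Type*} [AddCommGroup V] [Module K V] {h : V →ₛₗ[σ] V →ₗ[K] K}

theorem isIsotropic_span_singleton {v : V} : IsIsotropic h (K ∙ v) ↔ h v v = 0 := by
  constructor
  · intro hv
    exact hv (Submodule.mem_span_singleton_self v) v (Submodule.mem_span_singleton_self v)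
  · intro hv x hx y hy
    obtain ⟨a, rfl⟩ := Submodule.mem_span_singleton.1 hx
    obtain ⟨b, rfl⟩ := Submodule.mem_span_singleton.1 hy
    rw [map_smul, map_smulₛₗ, LinearMap.smul_apply, hv, smul_zero, smul_zero]

theorem ne_zero_of_diag_ne_zero {v : V} (hv : h v v ≠ 0) : v ≠ 0 := by
  rintro rfl
  exact hv (map_zero _)

/-- The non-isotropic point spanned by a vector `v` with `h v v ≠ 0`. -/
def pointOf (v : V) (hv : h v v ≠ 0) : NonIsotropicPoint h :=
  ⟨Projectivization.mk K v (ne_zero_of_diag_ne_zero hv), by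
    rwa [Projectivization.submodule_mk, isIsotropic_span_singleton]⟩

theorem exists_eq_pointOf (x : NonIsotropicPoint h) :
    ∃ (v : V) (hv : h v v ≠ 0), x = pointOf v hv := by
  obtain ⟨x, hx⟩ := x
  refine ⟨x.rep, ?_, Subtype.ext (Projectivization.mk_rep x).symm⟩
  rwa [Projectivization.submodule_eq, isIsotropic_span_singleton] at hx

theorem pointOf_le_iff {v : V} (hv : h v v ≠ 0) {U : Submodule K V} :
    (pointOf v hv).1.submodule ≤ U ↔ v ∈ U := by
  rw [pointOf, Projectivization.submodule_mk, Submodule.span_singleton_le_iff_mem]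

theorem pointOf_eq_iff {v w : V} (hv : h v v ≠ 0) (hw : h w w ≠ 0) :
    pointOf v hv = pointOf w hw ↔ ∃ a : K, a • w = v := by
  rw [pointOf, pointOf, Subtype.mk.injEq, Projectivization.mk_eq_mk_iff']

theorem adj_pointOf_iff (hs : h.IsSymm) {v w : V} (hv : h v v ≠ 0) (hw : h w w ≠ 0) :
    (graph h hs).Adj (pointOf v hv) (pointOf w hw) ↔ h v w = 0 := by
  change (pointOf v hv).1.submodule ≤ _ ↔ _
  rw [pointOf_le_iff]
  constructor
  · intro hvw
    refine hs.isRefl _ _ (hvw w ?_)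
    rw [pointOf, Projectivization.submodule_mk]
    exact Submodule.mem_span_singleton_self w
  · intro hvw y hy
    rw [pointOf, Projectivization.submodule_mk] at hy
    obtain ⟨a, rfl⟩ := Submodule.mem_span_singleton.1 hy
    rw [map_smulₛₗ, LinearMap.smul_apply, hs.isRefl _ _ hvw, smul_zero]

theorem adj_pointOf_iff_le_ker (hs : h.IsSymm) {v : V} (hv : h v v ≠ 0)
    (x : NonIsotropicPoint h) :
    (graph h hs).Adj (pointOf v hv) x ↔ x.1.submodule ≤ LinearMap.ker (h v) := by
  obtain ⟨w, hw, rfl⟩ := exists_eq_pointOf x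
  rw [adj_pointOf_iff, pointOf_le_iff, LinearMap.mem_ker]

instance [Finite K] [FiniteDimensional K V] : Finite (NonIsotropicPoint h) := by
  have : Finite V := Module.finite_of_finite K
  unfold NonIsotropicPoint
  infer_instance

end Points

/-! ### Counting non-isotropic points -/

section PointCount

variable {K : Type*} [Field K] [Finite K] {r : ℕ} {σ : K →+* K}
  {V : Type*} [AddCommGroup V] [Module K V] [FiniteDimensional K V] {h : V →ₛₗ[σ] V →ₗ[K] K}

/-- The set of non-isotropic points contained in a subspace. -/
def pointsIn (h : V →ₛₗ[σ] V →ₗ[K] K) (U : Submodule K V) : Set (NonIsotropicPoint h) :=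
  {x | x.1.submodule ≤ U}

open Classical in
/-- Each non-isotropic point of `U` is spanned by `q - 1` vectors. -/
theorem ncard_pointsIn_mul (U : Submodule K V) :
    (pointsIn h U).ncard * (Nat.card K - 1) + Nat.card {v : U // h v v = 0} = Nat.card U := by
  have : Finite V := Module.finite_of_finite K
  have e : (pointsIn h U × Kˣ) ≃ {v : U // ¬ h v v = 0} := by
    have hrep : ∀ x : pointsIn h U, x.1.1.rep ∈ U ∧ h x.1.1.rep x.1.1.rep ≠ 0 := by
      rintro ⟨⟨x, hx⟩, hxU⟩
      have hxU : x.submodule ≤ U := hxU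
      rw [Projectivization.submodule_eq, isIsotropic_span_singleton] at hx
      rw [Projectivization.submodule_eq, Submodule.span_singleton_le_iff_mem] at hxU
      exact ⟨hxU, hx⟩
    refine Equiv.ofBijective (fun p => ⟨⟨(p.2 : K) • p.1.1.1.rep, U.smul_mem _ (hrep p.1).1⟩, ?_⟩)
      ⟨?_, ?_⟩
    · simpa using (hrep p.1).2
    · rintro ⟨x, a⟩ ⟨y, b⟩ hxy
      have hxy : (a : K) • x.1.1.rep = (b : K) • y.1.1.rep :=
        congrArg (fun v => (v.1 : V)) hxy
      have h1 : x.1.1 = y.1.1 := by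
        rw [← Projectivization.mk_rep x.1.1, ← Projectivization.mk_rep y.1.1,
          Projectivization.mk_eq_mk_iff']
        refine ⟨(a : K)⁻¹ * b, ?_⟩
        rw [mul_smul, ← hxy, smul_smul, inv_mul_cancel₀ a.ne_zero, one_smul]
      have h2 : x = y := Subtype.ext (Subtype.ext h1)
      subst h2
      have h3 : a = b := Units.ext (smul_left_injective K x.1.1.rep_nonzero hxy)
      rw [h3]
    · rintro ⟨⟨v, hv⟩, hvv⟩
      have hvv : h v v ≠ 0 := hvv
      obtain ⟨a, ha⟩ := Projectivization.exists_smul_eq_mk_rep K v (ne_zero_of_diag_ne_zero hvv)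
      refine ⟨⟨⟨pointOf v hvv, (pointOf_le_iff hvv).2 hv⟩, a⁻¹⟩, ?_⟩
      refine Subtype.ext (Subtype.ext ?_)
      change ((a⁻¹ : Kˣ) : K) • (Projectivization.mk K v _).rep = v
      rw [← ha, ← Units.smul_def, inv_smul_smul]
  rw [← Nat.card_units, ← Nat.card_coe_set_eq, ← Nat.card_prod, Nat.card_congr e, ← Nat.card_sum]
  exact Nat.card_congr ((Equiv.sumComm _ _).trans (Equiv.sumCompl fun v : U => h v v = 0))

/-- The number of non-isotropic points of a subspace `U` depends only on `d = dim rad U` and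
`k = dim U - d`. -/
theorem ncard_pointsIn (hK : Nat.card K = r ^ 2) (hσ : ∀ a, σ a = a ^ r) (hs : h.IsSymm)
    {d k : ℕ} {U : Submodule K V} (hd : Module.finrank K (radical h U) = d)
    (hU : Module.finrank K U = d + k) :
    ((pointsIn h U).ncard : ℤ) * ((r : ℤ) ^ 2 - 1) =
      (r ^ 2) ^ (d + k) - (r ^ 2) ^ d * isotropicCount r k := by
  have h1 := ncard_pointsIn_mul (h := h) U
  have h2 := card_isotropic hK hσ hs k U (by omega)
  have h3 : 1 ≤ r ^ 2 := hK ▸ Nat.card_pos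
  rw [Module.natCard_eq_pow_finrank (K := K) (V := U), hK, hU] at h1
  zify [h3] at h1
  rw [h2, hd] at h1
  linear_combination h1

/-- The common neighbours of a triangle are the non-isotropic points of a nondegenerate subspace of
codimension `3`. -/
theorem ncard_commonNeighbors₃ (hK : Nat.card K = r ^ 2) (hσ : ∀ a, σ a = a ^ r)
    (hh : IsNondegHermitian h) {k : ℕ} (hk : Module.finrank K V = k + 3)
    {x y z : NonIsotropicPoint h} (ht : IsTriangle (graph h hh.1) x y z) :
    ((commonNeighbors₃ (graph h hh.1) x y z).ncard : ℤ) * ((r : ℤ) ^ 2 - 1) =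
      (r ^ 2) ^ k - isotropicCount r k := by
  obtain ⟨u, hu, rfl⟩ := exists_eq_pointOf x
  obtain ⟨v, hv, rfl⟩ := exists_eq_pointOf y
  obtain ⟨w, hw, rfl⟩ := exists_eq_pointOf z
  obtain ⟨huv, huw, hvw⟩ := ht
  rw [adj_pointOf_iff] at huv huw hvw
  have hset : commonNeighbors₃ (graph h hh.1) (pointOf u hu) (pointOf v hv) (pointOf w hw) =
      pointsIn h (⊤ ⊓ LinearMap.ker (h u) ⊓ LinearMap.ker (h v) ⊓ LinearMap.ker (h w)) := by
    ext x
    simp only [commonNeighbors₃, Set.mem_inter_iff, SimpleGraph.mem_neighborSet,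
      adj_pointOf_iff_le_ker, pointsIn, Set.mem_ofPred_eq, le_inf_iff, le_top, true_and]
  have hv' : v ∈ ⊤ ⊓ LinearMap.ker (h u) := mem_inf_ker.2 ⟨trivial, huv⟩
  have hw' : w ∈ ⊤ ⊓ LinearMap.ker (h u) ⊓ LinearMap.ker (h v) :=
    mem_inf_ker.2 ⟨mem_inf_ker.2 ⟨trivial, huw⟩, hvw⟩
  have d1 := finrank_inf_ker (φ := h u) (Submodule.mem_top (x := u)) hu
  have d2 := finrank_inf_ker hv' hv
  have d3 := finrank_inf_ker hw' hw
  rw [finrank_top] at d1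
  have hr := (radical_inf_ker hh.1 hw' hw).trans ((radical_inf_ker hh.1 hv' hv).trans
    ((radical_inf_ker hh.1 Submodule.mem_top hu).trans (radical_top_eq_bot hh)))
  have := ncard_pointsIn hK hσ hh.1 (d := 0) (k := k)
    (U := ⊤ ⊓ LinearMap.ker (h u) ⊓ LinearMap.ker (h v) ⊓ LinearMap.ker (h w))
    (by rw [hr, finrank_bot]) (by omega)
  rw [hset, this, zero_add, pow_zero, one_mul]

theorem exists_ncard_commonNeighbors₃_eq (hK : Nat.card K = r ^ 2) (hσ : ∀ a, σ a = a ^ r)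
    (hh : IsNondegHermitian h) (hn : 3 ≤ Module.finrank K V) :
    ∃ N : ℕ, ∀ x y z : NonIsotropicPoint h, IsTriangle (graph h hh.1) x y z →
      (commonNeighbors₃ (graph h hh.1) x y z).ncard = N := by
  by_cases hex : ∃ x y z, IsTriangle (graph h hh.1) x y z
  · obtain ⟨x₀, y₀, z₀, h₀⟩ := hex
    refine ⟨(commonNeighbors₃ (graph h hh.1) x₀ y₀ z₀).ncard, fun x y z ht => ?_⟩
    have hk : Module.finrank K V = (Module.finrank K V - 3) + 3 := by omega
    have h1 := ncard_commonNeighbors₃ hK hσ hh hk ht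
    rw [← ncard_commonNeighbors₃ hK hσ hh hk h₀] at h1
    have h2 : (r : ℤ) ^ 2 - 1 ≠ 0 := by
      have : (2 : ℤ) ≤ r := by exact_mod_cast two_le_of_card hK
      nlinarith
    exact_mod_cast mul_right_cancel₀ h2 h1
  · push Not at hex
    exact ⟨0, fun x y z ht => absurd ht (hex x y z)⟩

end PointCount

/-! ### Frames of switching pairs -/

section Frames

variable {K : Type*} [Field K] {r : ℕ} {σ : K →+* K}
  {V : Type*} [AddCommGroup V] [Module K V] {h : V →ₛₗ[σ] V →ₗ[K] K}

/-- Vectors `e`, `u`, `w` such that `L₁ = ⟨e, u⟩` and `L₂ = ⟨e, w⟩` form a switching pair: `e` is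
isotropic and orthogonal to `u` and `w`, the latter are non-isotropic, and their Gram determinant
is nonzero. -/
structure IsSwitchingFrame (h : V →ₛₗ[σ] V →ₗ[K] K) (e u w : V) : Prop where
  ne_zero : e ≠ 0
  ee : h e e = 0
  eu : h e u = 0
  ew : h e w = 0
  uu : h u u ≠ 0
  ww : h w w ≠ 0
  det : h u u * h w w ≠ h u w * h w u

theorem IsSwitchingFrame.swap {e u w : V} (hf : IsSwitchingFrame h e u w) :
    IsSwitchingFrame h e w u :=
  ⟨hf.ne_zero, hf.ee, hf.ew, hf.eu, hf.ww, hf.uu, fun hdet =>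
    hf.det (by linear_combination hdet)⟩

theorem IsSwitchingFrame.notMem {e u w : V} (hs : h.IsSymm) (hf : IsSwitchingFrame h e u w) :
    u ∉ Submodule.span K {e, w} := by
  intro hu
  obtain ⟨a, b, hab⟩ := Submodule.mem_span_pair.1 hu
  have h1 := congrArg (h u) hab
  have h2 := congrArg (h w) hab
  rw [map_add, map_smul, map_smul, smul_eq_mul, smul_eq_mul, hs.isRefl _ _ hf.eu] at h1
  rw [map_add, map_smul, map_smul, smul_eq_mul, smul_eq_mul, hs.isRefl _ _ hf.ew] at h2
  exact hf.det (by linear_combination h u w * h2 - h w w * h1)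

theorem IsSwitchingFrame.inf_eq {e u w : V} (hs : h.IsSymm) (hf : IsSwitchingFrame h e u w) :
    Submodule.span K {e, u} ⊓ Submodule.span K {e, w} = K ∙ e := by
  apply le_antisymm
  · rintro v ⟨h1, h2⟩
    obtain ⟨a, b, rfl⟩ := Submodule.mem_span_pair.1 h1
    by_cases hb : b = 0
    · subst hb
      rw [zero_smul, add_zero]
      exact Submodule.smul_mem _ _ (Submodule.mem_span_singleton_self e)
    · refine absurd ?_ (hf.notMem hs)
      have h3 : b • u ∈ Submodule.span K {e, w} := by
        have := Submodule.sub_mem _ h2 (Submodule.smul_mem _ a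
          (Submodule.subset_span (by simp : e ∈ ({e, w} : Set V))))
        rwa [add_sub_cancel_left] at this
      exact (Submodule.smul_mem_iff _ hb).1 h3
  · rw [Submodule.span_singleton_le_iff_mem]
    exact ⟨Submodule.subset_span (by simp), Submodule.subset_span (by simp)⟩

theorem IsSwitchingFrame.radical_eq {e u w : V} (hs : h.IsSymm) (hf : IsSwitchingFrame h e u w) :
    radical h (Submodule.span K {e, u}) = K ∙ e := by
  ext v
  rw [mem_radical hs, Submodule.mem_span_singleton]
  constructor
  · rintro ⟨hv, hy⟩
    obtain ⟨a, b, rfl⟩ := Submodule.mem_span_pair.1 hv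
    have h1 := hs.isRefl _ _ (hy u (Submodule.subset_span (by simp)))
    rw [map_add, map_smul, map_smul, smul_eq_mul, smul_eq_mul, hs.isRefl _ _ hf.eu, mul_zero,
      zero_add] at h1
    have hb : b = 0 := (mul_eq_zero.1 h1).resolve_right hf.uu
    exact ⟨a, by rw [hb, zero_smul, add_zero]⟩
  · rintro ⟨a, rfl⟩
    refine ⟨Submodule.smul_mem _ _ (Submodule.subset_span (by simp)), fun y hy => ?_⟩
    obtain ⟨b, c, rfl⟩ := Submodule.mem_span_pair.1 hy
    simp [hf.ee, hf.eu]

theorem IsSwitchingFrame.finrank_eq [FiniteDimensional K V] {e u w : V} (hs : h.IsSymm)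
    (hf : IsSwitchingFrame h e u w) : Module.finrank K (Submodule.span K {e, u}) = 2 := by
  have hu : u ∈ Submodule.span K {e, u} := Submodule.subset_span (by simp)
  have h1 : Submodule.span K {e, u} ⊓ LinearMap.ker (h u) = K ∙ e := by
    ext v
    rw [mem_inf_ker, Submodule.mem_span_singleton]
    constructor
    · rintro ⟨hv, huv⟩
      obtain ⟨a, b, rfl⟩ := Submodule.mem_span_pair.1 hv
      rw [map_add, map_smul, map_smul, smul_eq_mul, smul_eq_mul, hs.isRefl _ _ hf.eu, mul_zero,
        zero_add] at huv
      have hb : b = 0 := (mul_eq_zero.1 huv).resolve_right hf.uu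
      exact ⟨a, by rw [hb, zero_smul, add_zero]⟩
    · rintro ⟨a, rfl⟩
      exact ⟨Submodule.smul_mem _ _ (Submodule.subset_span (by simp)),
        by rw [map_smul, hs.isRefl _ _ hf.eu, smul_zero]⟩
  rw [← finrank_inf_ker hu hf.uu, h1, finrank_span_singleton hf.ne_zero]

theorem IsSwitchingFrame.isSwitchingPair [FiniteDimensional K V] {e u w : V} (hs : h.IsSymm)
    (hf : IsSwitchingFrame h e u w) :
    IsSwitchingPair h 3 (Submodule.span K {e, u}) (Submodule.span K {e, w}) where
  nonisotropic_left hiso := hf.uu (hiso (Submodule.subset_span (by simp)) u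
    (Submodule.subset_span (by simp)))
  nonisotropic_right hiso := hf.ww (hiso (Submodule.subset_span (by simp)) w
    (Submodule.subset_span (by simp)))
  finrank_left := by rw [hf.finrank_eq hs]
  finrank_right := by rw [hf.swap.finrank_eq hs]
  finrank_inf := by rw [hf.inf_eq hs, finrank_span_singleton hf.ne_zero]
  radical_left := by rw [hf.inf_eq hs, hf.radical_eq hs]
  radical_right := by rw [hf.inf_eq hs, hf.swap.radical_eq hs]

/-- The vectors of `⟨e, u⟩ + ⟨e, w⟩` in coordinates. -/
theorem mem_span_pair_sup {e u w v : V} :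
    v ∈ Submodule.span K {e, u} ⊔ Submodule.span K {e, w} ↔
      ∃ a b c : K, v = a • e + b • u + c • w := by
  rw [Submodule.mem_sup]
  constructor
  · rintro ⟨y, hy, z, hz, rfl⟩
    obtain ⟨a, b, rfl⟩ := Submodule.mem_span_pair.1 hy
    obtain ⟨c, d, rfl⟩ := Submodule.mem_span_pair.1 hz
    exact ⟨a + c, b, d, by module⟩
  · rintro ⟨a, b, c, rfl⟩
    exact ⟨a • e + b • u, Submodule.mem_span_pair.2 ⟨a, b, rfl⟩, c • w,
      Submodule.mem_span_pair.2 ⟨0, c, by module⟩, rfl⟩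

theorem IsSwitchingFrame.isUnitaryQuotient [FiniteDimensional K V] {e u w : V} (hs : h.IsSymm)
    (hf : IsSwitchingFrame h e u w) :
    IsUnitaryQuotient h (Submodule.span K {e, u} ⊔ Submodule.span K {e, w})
      (Submodule.span K {e, u} ⊓ Submodule.span K {e, w}) 2 := by
  have hfin := Submodule.finrank_sup_add_finrank_inf_eq (Submodule.span K {e, u})
    (Submodule.span K {e, w})
  rw [hf.finrank_eq hs, hf.swap.finrank_eq hs] at hfin
  rw [hf.inf_eq hs] at hfin ⊢
  rw [finrank_span_singleton hf.ne_zero] at hfin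
  set P := Submodule.span K {e, u} ⊔ Submodule.span K {e, w} with hP
  have hle : (K ∙ e) ≤ P := by
    rw [Submodule.span_singleton_le_iff_mem, mem_span_pair_sup]
    exact ⟨1, 0, 0, by module⟩
  have hort : ∀ y ∈ P, h e y = 0 := by
    intro y hy
    obtain ⟨a, b, c, rfl⟩ := mem_span_pair_sup.1 hy
    simp [hf.ee, hf.eu, hf.ew]
  refine ⟨hle, ?_, ?_⟩
  · have h1 := Submodule.finrank_quotient_add_finrank ((K ∙ e).submoduleOf P)
    rw [LinearEquiv.finrank_eq (Submodule.submoduleOfEquivOfLe hle),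
      finrank_span_singleton hf.ne_zero] at h1
    omega
  -- The induced form is computed on representatives given by a linear section of `P → P / p`.
  obtain ⟨s, hsec⟩ := ((K ∙ e).submoduleOf P).mkQ.exists_rightInverse_of_surjective
    (LinearMap.range_eq_top.2 (Submodule.mkQ_surjective _))
  have hdiff : ∀ v : P, ∃ a : K, (s (Submodule.Quotient.mk v) : V) = v + a • e := by
    intro v
    have h1 := LinearMap.congr_fun hsec (Submodule.Quotient.mk v)
    have h2 : s (Submodule.Quotient.mk v) - v ∈ (K ∙ e).submoduleOf P :=
      (Submodule.Quotient.eq _).1 h1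
    obtain ⟨a, ha⟩ := Submodule.mem_span_singleton.1 (Submodule.mem_comap.1 h2)
    refine ⟨a, ?_⟩
    rw [ha]
    simp
  let j : (P ⧸ (K ∙ e).submoduleOf P) →ₗ[K] V := P.subtype ∘ₗ s
  let hq : (P ⧸ (K ∙ e).submoduleOf P) →ₛₗ[σ] (P ⧸ (K ∙ e).submoduleOf P) →ₗ[K] K :=
    (h.comp j).compl₂ j
  have hqmk : ∀ x y : P, hq (Submodule.Quotient.mk x) (Submodule.Quotient.mk y) = h x y := by
    intro x y
    change h (s (Submodule.Quotient.mk x) : V) (s (Submodule.Quotient.mk y) : V) = h x y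
    obtain ⟨a, ha⟩ := hdiff x
    obtain ⟨b, hb⟩ := hdiff y
    rw [ha, hb]
    simp [hf.ee, hort y y.2, hs.isRefl _ _ (hort x x.2)]
  refine ⟨hq, hqmk, isNondegHermitian_of_left ⟨fun x y => hs.eq _ _⟩ ?_⟩
  intro x hx
  obtain ⟨v, rfl⟩ := Submodule.Quotient.mk_surjective _ x
  have hv : ∀ y ∈ P, h y v = 0 := fun y hy => hs.isRefl _ _ (by
    rw [← hqmk v ⟨y, hy⟩, hx])
  rw [Submodule.Quotient.mk_eq_zero]
  obtain ⟨a, b, c, habc⟩ := mem_span_pair_sup.1 v.2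
  have hu := hv u (mem_span_pair_sup.2 ⟨0, 1, 0, by module⟩)
  have hw := hv w (mem_span_pair_sup.2 ⟨0, 0, 1, by module⟩)
  rw [habc] at hu hw
  simp only [map_add, map_smul, smul_eq_mul, hs.isRefl _ _ hf.eu, hs.isRefl _ _ hf.ew] at hu hw
  have hdet : h u u * h w w - h u w * h w u ≠ 0 := sub_ne_zero.2 hf.det
  have hb : b = 0 := (mul_eq_zero.1 (by linear_combination h w w * hu - h u w * hw :
    b * (h u u * h w w - h u w * h w u) = 0)).resolve_right hdet
  have hc : c = 0 := (mul_eq_zero.1 (by linear_combination h u u * hw - h w u * hu :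
    c * (h u u * h w w - h u w * h w u) = 0)).resolve_right hdet
  refine Submodule.mem_comap.2 (Submodule.mem_span_singleton.2 ⟨a, ?_⟩)
  rw [Submodule.subtype_apply, habc, hb, hc]
  module

/-- Every switching pair of planes with nondegenerate quotient comes from a frame. -/
theorem exists_isSwitchingFrame [FiniteDimensional K V] (hs : h.IsSymm) {L₁ L₂ : Submodule K V}
    (hp : IsSwitchingPair h 3 L₁ L₂) (hq : IsUnitaryQuotient h (L₁ ⊔ L₂) (L₁ ⊓ L₂) 2) :
    ∃ e u w, IsSwitchingFrame h e u w ∧ L₁ = Submodule.span K {e, u} ∧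
      L₂ = Submodule.span K {e, w} := by
  have hd₁ := hp.finrank_left
  have hd₂ := hp.finrank_right
  have hd := hp.finrank_inf
  have hgen : ∀ L : Submodule K V, Module.finrank K L = 2 → L₁ ⊓ L₂ = radical h L →
      ∃ u ∈ L, u ∉ L₁ ⊓ L₂ ∧ h u u ≠ 0 ∧ L = (L₁ ⊓ L₂) ⊔ (K ∙ u) := by
    intro L hL hrad
    have hle : L₁ ⊓ L₂ ≤ L := hrad ▸ inf_le_left
    have hlt : L₁ ⊓ L₂ < L := lt_of_le_of_ne hle fun heq => by rw [heq] at hd; omega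
    obtain ⟨u, hu, hup⟩ := SetLike.exists_of_lt hlt
    have hsup : (L₁ ⊓ L₂) ⊔ (K ∙ u) = L := by
      apply Submodule.eq_of_le_of_finrank_le
      · exact sup_le hle (by rwa [Submodule.span_singleton_le_iff_mem])
      · have : L₁ ⊓ L₂ < (L₁ ⊓ L₂) ⊔ (K ∙ u) := lt_of_le_of_ne le_sup_left fun heq => hup (by
          rw [heq]
          exact Submodule.mem_sup_right (Submodule.mem_span_singleton_self u))
        have := Submodule.finrank_lt_finrank_of_lt this
        omega
    refine ⟨u, hu, hup, fun huu => hup ?_, hsup.symm⟩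
    rw [hrad, mem_radical hs]
    refine ⟨hu, fun y hy => ?_⟩
    rw [← hsup] at hy
    obtain ⟨p, hp', z, hz, rfl⟩ := Submodule.mem_sup.1 hy
    obtain ⟨a, rfl⟩ := Submodule.mem_span_singleton.1 hz
    rw [hrad, mem_radical hs] at hp'
    rw [map_add, map_smul, huu, smul_zero, add_zero]
    exact hs.isRefl _ _ (hp'.2 u hu)
  obtain ⟨u, huL, hup, huu, hL₁⟩ := hgen L₁ (by omega) hp.radical_left
  obtain ⟨w, hwL, hwp, hww, hL₂⟩ := hgen L₂ (by omega) hp.radical_right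
  have hbot : L₁ ⊓ L₂ ≠ ⊥ := fun heq => by
    rw [heq, finrank_bot] at hd
    omega
  obtain ⟨e, he, he0⟩ := Submodule.exists_mem_ne_zero_of_ne_bot hbot
  have hspan : L₁ ⊓ L₂ = K ∙ e := by
    symm
    apply Submodule.eq_of_le_of_finrank_le
    · rwa [Submodule.span_singleton_le_iff_mem]
    · rw [finrank_span_singleton he0]
      omega
  have h₁ := (mem_radical hs).1 (hp.radical_left ▸ he)
  have h₂ := (mem_radical hs).1 (hp.radical_right ▸ he)
  have hL₁' : L₁ = Submodule.span K {e, u} := by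
    rw [Submodule.span_insert, ← hspan]
    exact hL₁
  have hL₂' : L₂ = Submodule.span K {e, w} := by
    rw [Submodule.span_insert, ← hspan]
    exact hL₂
  refine ⟨e, u, w, ⟨he0, h₁.2 e h₁.1, h₁.2 u huL, h₂.2 w hwL, huu, hww, fun hdet => hwp ?_⟩,
    hL₁', hL₂'⟩
  -- A vanishing determinant puts a vector of `w + ⟨u⟩` into the radical of `P`, hence into `p`.
  obtain ⟨hle, -, b, hb, -, hnd⟩ := hq
  have hmP : w - (h u w / h u u) • u ∈ L₁ ⊔ L₂ := Submodule.sub_mem _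
    (Submodule.mem_sup_right hwL) (Submodule.smul_mem _ _ (Submodule.mem_sup_left huL))
  have hm : ∀ y ∈ L₁ ⊔ L₂, h y (w - (h u w / h u u) • u) = 0 := by
    intro y hy
    rw [hL₁', hL₂'] at hy
    obtain ⟨a, b, c, rfl⟩ := mem_span_pair_sup.1 hy
    simp only [map_sub, map_add, LinearMap.add_apply, map_smulₛₗ, LinearMap.smul_apply,
      smul_eq_mul, h₁.2 u huL, h₂.2 w hwL, RingHom.id_apply]
    field_simp
    linear_combination σ c * hdet
  have h0 : Submodule.Quotient.mk (p := (L₁ ⊓ L₂).submoduleOf (L₁ ⊔ L₂))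
      ⟨w - (h u w / h u u) • u, hmP⟩ = 0 := by
    apply hnd.2
    intro y
    obtain ⟨y, rfl⟩ := Submodule.Quotient.mk_surjective _ y
    rw [hb]
    exact hm y y.2
  rw [Submodule.Quotient.mk_eq_zero] at h0
  have h3 : w - (h u w / h u u) • u ∈ L₁ ⊓ L₂ := h0
  refine ⟨?_, hwL⟩
  have := L₁.add_mem h3.1 (L₁.smul_mem (h u w / h u u) huL)
  rwa [sub_add_cancel] at this

/-- Switching frames exist: take a hyperbolic pair `e`, `f` and two orthogonal non-isotropic vectors
perpendicular to it. -/
theorem exists_isSwitchingFrame_of_finrank [Finite K] [FiniteDimensional K V]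
    (hK : Nat.card K = r ^ 2) (hσ : ∀ a, σ a = a ^ r) (hh : IsNondegHermitian h)
    (hn : 4 ≤ Module.finrank K V) :
    ∃ e u w, IsSwitchingFrame h e u w := by
  obtain ⟨β, hβ⟩ := exists_trace_eq_one hK hσ
  have htop := radical_top_eq_bot hh
  obtain ⟨e, he, he0, hee⟩ := exists_isotropic hK hσ hh.1 htop (by rw [finrank_top]; omega)
  obtain ⟨f, hf, hff, hef⟩ := exists_hyperbolic_partner hh.1 hβ htop he he0 hee
  have hr := radical_inf_ker_hyperbolic hh.1 htop he hf hee hff hef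
  have hd := finrank_inf_ker_hyperbolic hh.1 he hf hee hef
  rw [finrank_top] at hd
  obtain ⟨u, hu, huu⟩ := exists_diag_ne_zero_of_pos hh.1 hβ hr (by omega)
  have hd' := finrank_inf_ker (φ := h u) hu huu
  obtain ⟨w, hw, hww⟩ := exists_diag_ne_zero_of_pos hh.1 hβ
    ((radical_inf_ker hh.1 hu huu).trans hr) (by omega)
  obtain ⟨hw, huw⟩ := mem_inf_ker.1 hw
  refine ⟨e, u, w, he0, hee, (mem_inf_ker.1 (mem_inf_ker.1 hu).1).2,
    (mem_inf_ker.1 (mem_inf_ker.1 hw).1).2, huu, hww, ?_⟩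
  rw [huw, zero_mul]
  exact mul_ne_zero huu hww

end Frames

/-! ### The switching set of a frame -/

section SwitchingSet

variable {K : Type*} [Field K] {r : ℕ} {σ : K →+* K}
  {V : Type*} [AddCommGroup V] [Module K V] {h : V →ₛₗ[σ] V →ₗ[K] K} {e u w : V}

theorem form_add_smul_left (u : V) (a : K) {y : V} (hey : h e y = 0) :
    h (u + a • e) y = h u y := by
  simp [hey]

namespace IsSwitchingFrame

theorem diag_add_smul (hs : h.IsSymm) (hf : IsSwitchingFrame h e u w) (a : K) :
    h (u + a • e) (u + a • e) ≠ 0 := by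
  have hue := hs.isRefl _ _ hf.eu
  simpa [hf.ee, hf.eu, hue] using hf.uu

/-- The points `⟨u + a e⟩`, which are the points of `⟨e, u⟩` other than `⟨e⟩`. -/
def point (hs : h.IsSymm) (hf : IsSwitchingFrame h e u w) (a : K) : NonIsotropicPoint h :=
  pointOf (u + a • e) (hf.diag_add_smul hs a)

theorem point_injective (hs : h.IsSymm) (hf : IsSwitchingFrame h e u w) :
    Function.Injective (hf.point hs) := by
  intro a b hab
  obtain ⟨c, hc⟩ := (pointOf_eq_iff _ _).1 hab
  have hue := hs.isRefl _ _ hf.eu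
  have h1 := congrArg (h u) hc
  simp only [map_smul, map_add, smul_eq_mul, hue, mul_zero, add_zero] at h1
  have h2 : c = 1 := by
    have := hf.uu
    field_simp at h1
    exact h1
  rw [h2, one_smul, add_right_inj] at hc
  exact (smul_left_injective K hf.ne_zero hc).symm

/-- The set `C₁` of the switching pair `⟨e, u⟩`, `⟨e, w⟩`. -/
theorem pointsDiff_eq (hs : h.IsSymm) (hf : IsSwitchingFrame h e u w) :
    pointsDiff h (Submodule.span K {e, u}) (Submodule.span K {e, w}) =
      Set.range (hf.point hs) := by
  ext x
  constructor
  · rintro ⟨h1, h2⟩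
    obtain ⟨v, hv, rfl⟩ := exists_eq_pointOf x
    rw [pointOf_le_iff] at h1 h2
    obtain ⟨a, b, rfl⟩ := Submodule.mem_span_pair.1 h1
    have hb : b ≠ 0 := by
      rintro rfl
      exact h2 (Submodule.mem_span_pair.2 ⟨a, 0, by module⟩)
    refine ⟨a / b, (pointOf_eq_iff _ _).2 ⟨b⁻¹, ?_⟩⟩
    rw [smul_add, smul_smul, smul_smul, inv_mul_cancel₀ hb, one_smul, add_comm, div_eq_inv_mul]
  · rintro ⟨a, rfl⟩
    refine ⟨(pointOf_le_iff _).2 (Submodule.mem_span_pair.2 ⟨a, 1, by module⟩), fun hle => ?_⟩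
    have h1 := (pointOf_le_iff _).1 hle
    have h2 := Submodule.sub_mem _ h1 (Submodule.smul_mem _ a
      (Submodule.subset_span (by simp : e ∈ ({e, w} : Set V))))
    rw [add_sub_cancel_right] at h2
    exact hf.notMem hs h2

theorem ncard_range_point (hs : h.IsSymm) (hf : IsSwitchingFrame h e u w) :
    (Set.range (hf.point hs)).ncard = Nat.card K := by
  rw [← Set.image_univ, Set.ncard_image_of_injective _ (hf.point_injective hs), Set.ncard_univ]

theorem adj_point_iff (hs : h.IsSymm) (hf : IsSwitchingFrame h e u w) {v : V} (hv : h v v ≠ 0)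
    (a : K) : (graph h hs).Adj (pointOf v hv) (hf.point hs a) ↔ h v u + a * h v e = 0 := by
  rw [point, adj_pointOf_iff, map_add, map_smul, smul_eq_mul]

/-- A point not orthogonal to `e` is adjacent to exactly one point of the line. -/
theorem neighborSet_inter_of_ne (hs : h.IsSymm) (hf : IsSwitchingFrame h e u w) {v : V}
    (hv : h v v ≠ 0) (hve : h v e ≠ 0) :
    (graph h hs).neighborSet (pointOf v hv) ∩ Set.range (hf.point hs) =
      {hf.point hs (-h v u / h v e)} := by
  ext x
  constructor
  · rintro ⟨h1, a, rfl⟩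
    rw [SimpleGraph.mem_neighborSet, adj_point_iff] at h1
    rw [Set.mem_singleton_iff]
    congr 1
    rw [eq_div_iff hve]
    linear_combination h1
  · rintro rfl
    refine ⟨(hf.adj_point_iff hs hv _).2 ?_, _, rfl⟩
    rw [div_mul_cancel₀ _ hve, add_neg_cancel]

theorem neighborSet_inter_eq (hs : h.IsSymm) (hf : IsSwitchingFrame h e u w) {v : V}
    (hv : h v v ≠ 0) (hve : h v e = 0) (hvu : h v u = 0) :
    (graph h hs).neighborSet (pointOf v hv) ∩ Set.range (hf.point hs) =
      Set.range (hf.point hs) := by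
  rw [Set.inter_eq_right]
  rintro _ ⟨a, rfl⟩
  refine (hf.adj_point_iff hs hv _).2 ?_
  rw [hve, hvu, mul_zero, add_zero]

theorem neighborSet_inter_eq_empty (hs : h.IsSymm) (hf : IsSwitchingFrame h e u w) {v : V}
    (hv : h v v ≠ 0) (hve : h v e = 0) (hvu : h v u ≠ 0) :
    (graph h hs).neighborSet (pointOf v hv) ∩ Set.range (hf.point hs) = ∅ := by
  rw [Set.eq_empty_iff_forall_notMem]
  rintro _ ⟨h1, a, rfl⟩
  rw [SimpleGraph.mem_neighborSet, adj_point_iff, hve, mul_zero, add_zero] at h1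
  exact hvu h1

open Classical in
/-- Each of the two parts is a coclique, and between them there are all edges or none. -/
theorem neighborSet_point_inter (hs : h.IsSymm) (hf : IsSwitchingFrame h e u w) (a : K) :
    ((graph h hs).neighborSet (hf.point hs a) ∩ Set.range (hf.point hs) = ∅) ∧
    (graph h hs).neighborSet (hf.point hs a) ∩ Set.range (hf.swap.point hs) =
      if h u w = 0 then Set.range (hf.swap.point hs) else ∅ := by
  have he : h (u + a • e) e = 0 := by rw [form_add_smul_left u a hf.ee, hs.isRefl _ _ hf.eu]
  refine ⟨hf.neighborSet_inter_eq_empty hs _ he ?_, ?_⟩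
  · rw [form_add_smul_left u a hf.eu]
    exact hf.uu
  · split_ifs with hw
    · exact hf.swap.neighborSet_inter_eq hs _ he (by rw [form_add_smul_left u a hf.ew, hw])
    · exact hf.swap.neighborSet_inter_eq_empty hs _ he (by rwa [form_add_smul_left u a hf.ew])

open Classical in
theorem isSwitchingSet [Finite K] (hs : h.IsSymm) (hf : IsSwitchingFrame h e u w) :
    IsSwitchingSet (graph h hs)
      (pointsDiff h (Submodule.span K {e, u}) (Submodule.span K {e, w}))
      (pointsDiff h (Submodule.span K {e, w}) (Submodule.span K {e, u})) where
  disjoint := Set.disjoint_left.2 fun _ h1 h2 => h1.2 h2.1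
  card_eq := by
    rw [hf.pointsDiff_eq hs, hf.swap.pointsDiff_eq hs, ncard_range_point, ncard_range_point]
  regular_each := by
    rw [hf.pointsDiff_eq hs, hf.swap.pointsDiff_eq hs]
    refine ⟨0, ?_, ?_⟩
    · rintro _ ⟨a, rfl⟩
      rw [(hf.neighborSet_point_inter hs a).1, Set.ncard_empty]
    · rintro _ ⟨a, rfl⟩
      rw [(hf.swap.neighborSet_point_inter hs a).1, Set.ncard_empty]
  regular_union := by
    rw [hf.pointsDiff_eq hs, hf.swap.pointsDiff_eq hs]
    refine ⟨if h u w = 0 then Nat.card K else 0, ?_⟩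
    rintro _ (⟨a, rfl⟩ | ⟨a, rfl⟩)
    · rw [Set.inter_union_distrib_left, (hf.neighborSet_point_inter hs a).1,
        (hf.neighborSet_point_inter hs a).2, Set.empty_union]
      split_ifs
      · exact ncard_range_point hs _
      · exact Set.ncard_empty _
    · rw [Set.inter_union_distrib_left, (hf.swap.neighborSet_point_inter hs a).1,
        (hf.swap.neighborSet_point_inter hs a).2, Set.union_empty, hs.isRefl.eq_iff]
      split_ifs
      · exact ncard_range_point hs _
      · exact Set.ncard_empty _
  outside := by
    rw [hf.pointsDiff_eq hs, hf.swap.pointsDiff_eq hs]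
    intro x _
    obtain ⟨v, hv, rfl⟩ := exists_eq_pointOf x
    by_cases hve : h v e = 0
    · rw [Set.inter_union_distrib_left]
      by_cases hvu : h v u = 0 <;> by_cases hvw : h v w = 0
      · left
        rw [hf.neighborSet_inter_eq hs hv hve hvu, hf.swap.neighborSet_inter_eq hs hv hve hvw,
          ncard_range_point, ncard_range_point]
      · right; left
        rw [hf.neighborSet_inter_eq hs hv hve hvu,
          hf.swap.neighborSet_inter_eq_empty hs hv hve hvw, Set.union_empty]
      · right; right
        rw [hf.neighborSet_inter_eq_empty hs hv hve hvu,
          hf.swap.neighborSet_inter_eq hs hv hve hvw, Set.empty_union]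
      · left
        rw [hf.neighborSet_inter_eq_empty hs hv hve hvu,
          hf.swap.neighborSet_inter_eq_empty hs hv hve hvw]
    · left
      rw [hf.neighborSet_inter_of_ne hs hv hve, hf.swap.neighborSet_inter_of_ne hs hv hve,
        Set.ncard_singleton, Set.ncard_singleton]

end IsSwitchingFrame

end SwitchingSet

/-! ### Common neighbours after switching -/

section SwitchTriangle

variable {W : Type*} {G : SimpleGraph W} {C₁ C₂ : Set W}

theorem switch_adj_of_notMem {x y : W} (hx : x ∉ C₁ ∪ C₂) (hy : y ∉ C₁ ∪ C₂) :
    (switch G C₁ C₂).Adj x y ↔ G.Adj x y := by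
  simp only [switch, hx, hy, not_false_eq_true, false_and, and_false, false_or, true_and]

theorem switch_adj_of_mem {x y : W} (hx : x ∈ C₁ ∪ C₂) (hy : y ∈ C₁ ∪ C₂) :
    (switch G C₁ C₂).Adj x y ↔ G.Adj x y := by
  simp only [switch, hx, hy, not_true_eq_false, false_and, and_false, false_or, true_and]

theorem switch_adj_of_notMem_of_mem {x y : W} (hx : x ∉ C₁ ∪ C₂) (hy : y ∈ C₁ ∪ C₂) :
    (switch G C₁ C₂).Adj x y ↔ y ∈ switchedNeighbors G C₁ C₂ x := by
  simp only [switch, hx, hy, not_true_eq_false, not_false_eq_true, false_and, and_false, or_false,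
    true_and, false_iff]

theorem switchedNeighbors_of_eq_right {x : W} (hx : G.neighborSet x ∩ (C₁ ∪ C₂) = C₂) :
    switchedNeighbors G C₁ C₂ x = C₁ := if_pos hx

theorem switchedNeighbors_of_eq_left (hne : C₁ ≠ C₂) {x : W}
    (hx : G.neighborSet x ∩ (C₁ ∪ C₂) = C₁) : switchedNeighbors G C₁ C₂ x = C₂ := by
  rw [switchedNeighbors, if_neg (by rwa [hx]), if_pos hx]

theorem switchedNeighbors_of_ne {x : W} (h₁ : G.neighborSet x ∩ (C₁ ∪ C₂) ≠ C₁)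
    (h₂ : G.neighborSet x ∩ (C₁ ∪ C₂) ≠ C₂) :
    switchedNeighbors G C₁ C₂ x = G.neighborSet x ∩ (C₁ ∪ C₂) := by
  rw [switchedNeighbors, if_neg h₂, if_neg h₁]

/-- A vertex with neighbours in both parts keeps its neighbourhood. -/
theorem switchedNeighbors_of_mem_of_mem (hdisj : Disjoint C₁ C₂) {x c d : W} (hc : c ∈ C₁)
    (hd : d ∈ C₂) (hxc : G.Adj x c) (hxd : G.Adj x d) :
    switchedNeighbors G C₁ C₂ x = G.neighborSet x ∩ (C₁ ∪ C₂) :=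
  switchedNeighbors_of_ne
    (fun heq => Set.disjoint_left.1 hdisj (heq ▸ ⟨hxd, Or.inr hd⟩ : d ∈ C₁) hd)
    (fun heq => Set.disjoint_left.1 hdisj hc (heq ▸ ⟨hxc, Or.inl hc⟩ : c ∈ C₂))

/-- Switching destroys exactly one common neighbour of three vertices outside `C₁ ∪ C₂` if the first
is switched away from `C₁` and the other two are unchanged, with exactly one common neighbour in
`C₁` and none in `C₂`. -/
theorem ncard_commonNeighbors₃_switch [Finite W] (hdisj : Disjoint C₁ C₂) {x y z c d d' : W}
    (hx : x ∉ C₁ ∪ C₂) (hy : y ∉ C₁ ∪ C₂) (hz : z ∉ C₁ ∪ C₂) (hc : c ∈ C₁) (hd : d ∈ C₂)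
    (hd' : d' ∈ C₂) (hxC : G.neighborSet x ∩ (C₁ ∪ C₂) = C₁)
    (hyC : G.neighborSet y ∩ (C₁ ∪ C₂) = {c, d}) (hzc : G.Adj z c) (hzd : ¬ G.Adj z d)
    (hzd' : G.Adj z d') :
    (commonNeighbors₃ (switch G C₁ C₂) x y z).ncard + 1 = (commonNeighbors₃ G x y z).ncard := by
  have hne : C₁ ≠ C₂ := by
    rintro rfl
    exact Set.disjoint_left.1 hdisj hc hc
  have hcd : c ≠ d := by
    rintro rfl
    exact Set.disjoint_left.1 hdisj hc hd
  have hyc : G.Adj y c := (hyC.symm ▸ Or.inl rfl : c ∈ G.neighborSet y ∩ (C₁ ∪ C₂)).1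
  have hyd : G.Adj y d := (hyC.symm ▸ Or.inr rfl : d ∈ G.neighborSet y ∩ (C₁ ∪ C₂)).1
  have hxc : G.Adj x c := (hxC.symm ▸ hc : c ∈ G.neighborSet x ∩ (C₁ ∪ C₂)).1
  have hmem : ∀ t, t ∈ commonNeighbors₃ (switch G C₁ C₂) x y z ↔
      t ∉ C₁ ∪ C₂ ∧ t ∈ commonNeighbors₃ G x y z := by
    intro t
    by_cases ht : t ∈ C₁ ∪ C₂
    · simp only [ht, not_true_eq_false, false_and, iff_false]
      rintro ⟨⟨h1, h2⟩, h3⟩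
      rw [SimpleGraph.mem_neighborSet, switch_adj_of_notMem_of_mem hx ht,
        switchedNeighbors_of_eq_left hne hxC] at h1
      rw [SimpleGraph.mem_neighborSet, switch_adj_of_notMem_of_mem hy ht,
        switchedNeighbors_of_mem_of_mem hdisj hc hd hyc hyd, hyC] at h2
      rw [SimpleGraph.mem_neighborSet, switch_adj_of_notMem_of_mem hz ht,
        switchedNeighbors_of_mem_of_mem hdisj hc hd' hzc hzd'] at h3
      rcases h2 with rfl | h2
      · exact Set.disjoint_left.1 hdisj hc h1
      · rw [Set.mem_singleton_iff] at h2
        subst h2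
        exact hzd h3.1
    · simp only [commonNeighbors₃, Set.mem_inter_iff, SimpleGraph.mem_neighborSet,
        switch_adj_of_notMem hx ht, switch_adj_of_notMem hy ht, switch_adj_of_notMem hz ht, ht,
        not_false_eq_true, true_and]
  have hinsert : commonNeighbors₃ G x y z =
      insert c (commonNeighbors₃ (switch G C₁ C₂) x y z) := by
    ext t
    rw [Set.mem_insert_iff, hmem]
    constructor
    · intro ht
      by_cases htC : t ∈ C₁ ∪ C₂
      · left
        have h1 : t ∈ C₁ := hxC ▸ ⟨ht.1.1, htC⟩
        have h2 : t ∈ ({c, d} : Set W) := hyC ▸ ⟨ht.1.2, htC⟩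
        rcases h2 with rfl | h2
        · rfl
        · rw [Set.mem_singleton_iff] at h2
          subst h2
          exact absurd hd (Set.disjoint_left.1 hdisj h1)
      · exact Or.inr ⟨htC, ht⟩
    · rintro (rfl | ⟨-, ht⟩)
      · exact ⟨⟨hxc, hyc⟩, hzc⟩
      · exact ht
  rw [hinsert, Set.ncard_insert_of_notMem]
  rw [hmem]
  exact fun hcc => hcc.1 (Or.inl hc)

theorem isTriangle_switch {x y z : W} (hx : x ∉ C₁ ∪ C₂) (hy : y ∉ C₁ ∪ C₂)
    (hz : z ∉ C₁ ∪ C₂) : IsTriangle (switch G C₁ C₂) x y z ↔ IsTriangle G x y z := by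
  rw [IsTriangle, switch_adj_of_notMem hx hy, switch_adj_of_notMem hx hz,
    switch_adj_of_notMem hy hz, IsTriangle]

theorem ncard_commonNeighbors₃_iso {W' : Type*} {G' : SimpleGraph W'} (φ : G ≃g G') (x y z : W) :
    (commonNeighbors₃ G' (φ x) (φ y) (φ z)).ncard = (commonNeighbors₃ G x y z).ncard := by
  have : commonNeighbors₃ G' (φ x) (φ y) (φ z) = φ '' commonNeighbors₃ G x y z := by
    ext t
    obtain ⟨t, rfl⟩ := φ.surjective t
    rw [φ.injective.mem_set_image]
    simp only [commonNeighbors₃, Set.mem_inter_iff, SimpleGraph.mem_neighborSet, φ.map_adj_iff]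
  rw [this, Set.ncard_image_of_injective _ φ.injective]

theorem isTriangle_iso {W' : Type*} {G' : SimpleGraph W'} (φ : G ≃g G') {x y z : W} :
    IsTriangle G' (φ x) (φ y) (φ z) ↔ IsTriangle G x y z := by
  simp only [IsTriangle, φ.map_adj_iff]

end SwitchTriangle

/-! ### The triangle losing a common neighbour -/

section Witness

variable {K : Type*} [Field K] {r : ℕ} {σ : K →+* K}
  {V : Type*} [AddCommGroup V] [Module K V] {h : V →ₛₗ[σ] V →ₗ[K] K} {e u w : V}

/-- The vectors `x`, `y`, `z` spanning the triangle, and a vector `s` orthogonal to `P` but not to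
`x`, which shows that `x` is not in `P`. In the nondegenerate space `u^⊥` let `w'` be the projection
of `w`, and split off hyperbolic pairs `e, f` and `t, t'` orthogonal to `w'`; this is where
dimension `6` is needed. -/
theorem exists_triangle_vectors [Finite K] [FiniteDimensional K V] (hK : Nat.card K = r ^ 2)
    (hσ : ∀ a, σ a = a ^ r) (hh : IsNondegHermitian h) (hn : 6 ≤ Module.finrank K V)
    (hf : IsSwitchingFrame h e u w) :
    ∃ x y z s : V, h x x ≠ 0 ∧ h y y ≠ 0 ∧ h z z ≠ 0 ∧ h x y = 0 ∧ h x z = 0 ∧ h y z = 0 ∧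
      h x e = 0 ∧ h x u = 0 ∧ h x w ≠ 0 ∧ h y e ≠ 0 ∧ h y u = 0 ∧ h y w = 0 ∧
      h z e ≠ 0 ∧ h z u = 0 ∧ h z w ≠ 0 ∧ h s x ≠ 0 ∧ h s e = 0 ∧ h s u = 0 ∧ h s w = 0 := by
  have hs := hh.1
  obtain ⟨β, hβ⟩ := exists_trace_eq_one hK hσ
  have huu := hf.uu
  have hue := hs.isRefl _ _ hf.eu
  obtain ⟨w', hw', hwe⟩ : ∃ w', w = w' + (h u w / h u u) • u ∧ w' = w - (h u w / h u u) • u :=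
    ⟨_, (sub_add_cancel _ _).symm, rfl⟩
  have huw' : h u w' = 0 := by
    rw [hwe, map_sub, map_smul, smul_eq_mul, div_mul_cancel₀ _ huu, sub_self]
  have hew' : h e w' = 0 := by rw [hwe, map_sub, map_smul, hf.ew, hf.eu, smul_zero, sub_zero]
  have hww' : h w' w' ≠ 0 := by
    intro h0
    apply hf.det
    have h2 : h w w' = h w' w' := by
      conv_lhs => rw [hw', map_add, LinearMap.add_apply, map_smulₛₗ, LinearMap.smul_apply, huw',
        smul_zero, add_zero]
    have h1 : h w' w' = h w w - h u w / h u u * h w u := by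
      rw [← h2, hwe, map_sub, map_smul, smul_eq_mul]
    rw [h0] at h1
    field_simp at h1
    linear_combination -h1
  have htop := radical_top_eq_bot hh
  have hw'U : w' ∈ ⊤ ⊓ LinearMap.ker (h u) := mem_inf_ker.2 ⟨trivial, huw'⟩
  have d1 := finrank_inf_ker (φ := h u) (Submodule.mem_top (x := u)) huu
  have d2 := finrank_inf_ker hw'U hww'
  rw [finrank_top] at d1
  have hrad : radical h (⊤ ⊓ LinearMap.ker (h u) ⊓ LinearMap.ker (h w')) = ⊥ :=
    (radical_inf_ker hs hw'U hww').trans ((radical_inf_ker hs Submodule.mem_top huu).trans htop)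
  set T := ⊤ ⊓ LinearMap.ker (h u) ⊓ LinearMap.ker (h w') with hT
  have hmemT : ∀ v ∈ T, h u v = 0 ∧ h w' v = 0 := fun v hv =>
    ⟨(mem_inf_ker.1 (mem_inf_ker.1 hv).1).2, (mem_inf_ker.1 hv).2⟩
  have heT : e ∈ T := mem_inf_ker.2 ⟨mem_inf_ker.2 ⟨trivial, hue⟩, hs.isRefl _ _ hew'⟩
  obtain ⟨f, hfT, hff, hef⟩ := exists_hyperbolic_partner hs hβ hrad heT hf.ne_zero hf.ee
  have hrad' := radical_inf_ker_hyperbolic hs hrad heT hfT hf.ee hff hef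
  have d3 := finrank_inf_ker_hyperbolic hs heT hfT hf.ee hef
  obtain ⟨t, ht, ht0, htt⟩ := exists_isotropic hK hσ hs hrad' (by omega)
  obtain ⟨t', ht', htt', htt1⟩ := exists_hyperbolic_partner hs hβ hrad' ht ht0 htt
  obtain ⟨ht, hft⟩ := mem_inf_ker.1 ht
  obtain ⟨ht, het⟩ := mem_inf_ker.1 ht
  obtain ⟨hut, hwt⟩ := hmemT t ht
  obtain ⟨ht', hft'⟩ := mem_inf_ker.1 ht'
  obtain ⟨ht', het'⟩ := mem_inf_ker.1 ht'
  obtain ⟨hut', hwt'⟩ := hmemT t' ht'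
  obtain ⟨huf, hwf⟩ := hmemT f hfT
  have hee := hf.ee
  have heu := hf.eu
  have hw'e := hs.isRefl _ _ hew'
  have hw'u := hs.isRefl _ _ huw'
  have hfe : h f e = 1 := by rw [← hs.eq, hef, map_one]
  have ht1 : h t' t = 1 := by rw [← hs.eq, htt1, map_one]
  have hfu := hs.isRefl _ _ huf
  have hfw := hs.isRefl _ _ hwf
  have hte := hs.isRefl _ _ het
  have htf := hs.isRefl _ _ hft
  have htu := hs.isRefl _ _ hut
  have htw := hs.isRefl _ _ hwt
  have hte' := hs.isRefl _ _ het'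
  have htf' := hs.isRefl _ _ hft'
  have htu' := hs.isRefl _ _ hut'
  have htw' := hs.isRefl _ _ hwt'
  have hinv := conj_conj hK hσ
  have hω := conj_self hs w'
  -- Orthogonality to `w` is the same as to `w'` for vectors of `u^⊥`.
  have hw : ∀ v, h v u = 0 → h v w = h v w' := fun v hv => by
    rw [hw', map_add, map_smul, hv, smul_zero, add_zero]
  have hx : h (w' + t) u = 0 := by simp [hw'u, htu]
  have hy : h (f + β • e) u = 0 := by simp [hfu, heu]
  -- The coefficient `η` of `t` makes `h z z = 1`.
  obtain ⟨η, hη⟩ : ∃ η : K, η + σ η = 2 - (h w' w')⁻¹ :=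
    ⟨β * (2 - (h w' w')⁻¹), by
      rw [map_mul, map_sub, map_inv₀, hω, map_ofNat]
      linear_combination (2 - (h w' w')⁻¹) * hβ⟩
  have hz : h (-(h w' w')⁻¹ • w' + f - σ β • e + t' + η • t) u = 0 := by
    simp [hw'u, hfu, heu, htu, htu']
  -- `t` is isotropic, so `h x x = h w' w'`, and it keeps `x` out of `P`, which is
  -- orthogonal to `t'`.
  refine ⟨w' + t, f + β • e, -(h w' w')⁻¹ • w' + f - σ β • e + t' + η • t, t', ?_, ?_, ?_, ?_, ?_,
    ?_, ?_, hx, ?_, ?_, hy, ?_, ?_, hz, ?_, ?_, hte', htu', ?_⟩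
  · simpa [htw, hwt, htt] using hww'
  · have : h (f + β • e) (f + β • e) = β + σ β := by simp [hff, hfe, hef, hee]
    rw [this, hβ]
    exact one_ne_zero
  · have : h (-(h w' w')⁻¹ • w' + f - σ β • e + t' + η • t)
        (-(h w' w')⁻¹ • w' + f - σ β • e + t' + η • t) = 1 := by
      simp only [map_add, map_sub, LinearMap.add_apply, LinearMap.sub_apply, map_smulₛₗ,
        LinearMap.smul_apply, smul_eq_mul, RingHom.id_apply, map_neg, map_inv₀, hω, hinv, hee,
        hef, hfe, hff, hwf, hfw, hw'e, hew', hwt, htw, hwt', htw', het, hte, het', hte', hft, htf,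
        hft', htf', htt, htt', htt1, ht1]
      field_simp
      field_simp at hη
      linear_combination hη - h w' w' * hβ
    rw [this]
    exact one_ne_zero
  · simp [hwf, hw'e, htf, hte]
  · simp [hwf, hw'e, htf, hte, hwt, htw, hwt', htt, htt1, hww']
  · simp [hfw, hew', hff, hfe, hef, hee, hft, hft', het, het']
  · simp [hw'e, hte]
  · rw [hw _ hx]
    simpa [htw] using hww'
  · simp [hfe, hee]
  · rw [hw _ hy]
    simp [hfw, hew']
  · simp [hw'e, hfe, hee, hte, hte']
  · rw [hw _ hz]
    simp [hfw, hew', htw, htw', hω, hww']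
  · simp [htw', ht1]
  · rw [hw _ htu', htw']

/-- The triangle losing one common neighbour. -/
theorem IsSwitchingFrame.exists_triangle [Finite K] [FiniteDimensional K V]
    (hK : Nat.card K = r ^ 2) (hσ : ∀ a, σ a = a ^ r) (hh : IsNondegHermitian h)
    (hn : 6 ≤ Module.finrank K V) (hf : IsSwitchingFrame h e u w) :
    ∃ x y z : NonIsotropicPoint h,
      ¬ x.1.submodule ≤ Submodule.span K {e, u} ⊔ Submodule.span K {e, w} ∧
      ¬ y.1.submodule ≤ Submodule.span K {e, u} ⊔ Submodule.span K {e, w} ∧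
      ¬ z.1.submodule ≤ Submodule.span K {e, u} ⊔ Submodule.span K {e, w} ∧
      IsTriangle (graph h hh.1) x y z ∧
      IsTriangle (switchedGraph h hh.1 (Submodule.span K {e, u}) (Submodule.span K {e, w})) x y z ∧
      (commonNeighbors₃ (switchedGraph h hh.1 (Submodule.span K {e, u})
        (Submodule.span K {e, w})) x y z).ncard + 1 =
        (commonNeighbors₃ (graph h hh.1) x y z).ncard := by
  have hs := hh.1
  obtain ⟨x, y, z, s, hx, hy, hz, hxy, hxz, hyz, hxe, hxu, hxw, hye, hyu, hyw, hze, hzu, hzw, hsx,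
    hse, hsu, hsw⟩ := exists_triangle_vectors hK hσ hh hn hf
  have hout : ∀ v ∈ Submodule.span K {e, u} ⊔ Submodule.span K {e, w},
      h e v = 0 ∧ h s v = 0 := by
    intro v hv
    obtain ⟨a, b, c, rfl⟩ := mem_span_pair_sup.1 hv
    simp [hf.ee, hf.eu, hf.ew, hse, hsu, hsw]
  have hxP : ¬ (pointOf x hx).1.submodule ≤
      Submodule.span K {e, u} ⊔ Submodule.span K {e, w} := fun hle =>
    hsx (hout x ((pointOf_le_iff hx).1 hle)).2
  have hyP : ¬ (pointOf y hy).1.submodule ≤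
      Submodule.span K {e, u} ⊔ Submodule.span K {e, w} := fun hle =>
    hye (hs.isRefl _ _ (hout y ((pointOf_le_iff hy).1 hle)).1)
  have hzP : ¬ (pointOf z hz).1.submodule ≤
      Submodule.span K {e, u} ⊔ Submodule.span K {e, w} := fun hle =>
    hze (hs.isRefl _ _ (hout z ((pointOf_le_iff hz).1 hle)).1)
  have hC : ∀ v : NonIsotropicPoint h,
      ¬ v.1.submodule ≤ Submodule.span K {e, u} ⊔ Submodule.span K {e, w} →
      v ∉ Set.range (hf.point hs) ∪ Set.range (hf.swap.point hs) := by
    intro v hv hmem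
    rw [← hf.pointsDiff_eq hs, ← hf.swap.pointsDiff_eq hs] at hmem
    rcases hmem with hmem | hmem
    · exact hv (hmem.1.trans le_sup_left)
    · exact hv (hmem.1.trans le_sup_right)
  have htri : IsTriangle (graph h hs) (pointOf x hx) (pointOf y hy) (pointOf z hz) :=
    ⟨(adj_pointOf_iff hs hx hy).2 hxy, (adj_pointOf_iff hs hx hz).2 hxz,
      (adj_pointOf_iff hs hy hz).2 hyz⟩
  have hdisj := (hf.isSwitchingSet hs).disjoint
  rw [switchedGraph]
  rw [hf.pointsDiff_eq hs, hf.swap.pointsDiff_eq hs] at hdisj ⊢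
  refine ⟨pointOf x hx, pointOf y hy, pointOf z hz, hxP, hyP, hzP, htri,
    (isTriangle_switch (hC _ hxP) (hC _ hyP) (hC _ hzP)).2 htri,
    ncard_commonNeighbors₃_switch hdisj (c := hf.point hs (-h y u / h y e))
      (d := hf.swap.point hs (-h y w / h y e)) (d' := hf.swap.point hs (-h z w / h z e))
      (hC _ hxP) (hC _ hyP) (hC _ hzP) ⟨_, rfl⟩ ⟨_, rfl⟩ ⟨_, rfl⟩ ?_ ?_ ?_ ?_ ?_⟩
  · rw [Set.inter_union_distrib_left, hf.neighborSet_inter_eq hs hx hxe hxu,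
      hf.swap.neighborSet_inter_eq_empty hs hx hxe hxw, Set.union_empty]
  · rw [Set.inter_union_distrib_left, hf.neighborSet_inter_of_ne hs hy hye,
      hf.swap.neighborSet_inter_of_ne hs hy hye]
    rfl
  · rw [hf.adj_point_iff hs hz, hyu, hzu]
    simp
  · rw [hf.swap.adj_point_iff hs hz, hyw]
    simpa using hzw
  · rw [hf.swap.adj_point_iff hs hz, div_mul_cancel₀ _ hze, add_neg_cancel]

end Witness

/-! ### Switching preserves strong regularity -/

section StronglyRegular

variable {W : Type*} {G : SimpleGraph W} {C₁ C₂ : Set W}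

theorem isSRG_iff_ncard [Finite W] {v k l m : ℕ} :
    IsSRG G v k l m ↔ Nat.card W = v ∧ (∀ x, (G.neighborSet x).ncard = k) ∧
      (∀ x y, G.Adj x y → (G.neighborSet x ∩ G.neighborSet y).ncard = l) ∧
      ∀ x y, x ≠ y → ¬ G.Adj x y → (G.neighborSet x ∩ G.neighborSet y).ncard = m := by
  classical
  constructor
  · rintro ⟨_, hG⟩
    refine ⟨by rw [Nat.card_eq_fintype_card, hG.card], fun x => ?_, fun x y hxy => ?_,
      fun x y hne hxy => ?_⟩
    · rw [← hG.regular x, ← SimpleGraph.card_neighborSet_eq_degree, ← Nat.card_coe_set_eq,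
        Nat.card_eq_fintype_card]
    · rw [← hG.of_adj x y hxy, ← Nat.card_coe_set_eq, ← Nat.card_eq_fintype_card]
      rfl
    · rw [← hG.of_not_adj hne hxy, ← Nat.card_coe_set_eq, ← Nat.card_eq_fintype_card]
      rfl
  · rintro ⟨h1, h2, h3, h4⟩
    refine ⟨Fintype.ofFinite W, ?_⟩
    let _ := Fintype.ofFinite W
    refine ⟨by rw [← Nat.card_eq_fintype_card, h1], fun x => ?_, fun x y hxy => ?_,
      fun x y hne hxy => ?_⟩
    · rw [← h2 x, ← SimpleGraph.card_neighborSet_eq_degree, ← Nat.card_coe_set_eq,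
        Nat.card_eq_fintype_card]
    · rw [← h3 x y hxy, ← Nat.card_coe_set_eq, ← Nat.card_eq_fintype_card]
      rfl
    · rw [← h4 x y hne hxy, ← Nat.card_coe_set_eq, ← Nat.card_eq_fintype_card]
      rfl

theorem IsSRG.compl {v k l m : ℕ} (hG : IsSRG G v k l m) :
    IsSRG Gᶜ v (v - k - 1) (v - (2 * k - m) - 2) (v - (2 * k - l)) := by
  classical
  obtain ⟨_, hG⟩ := hG
  refine ⟨inferInstance, ?_⟩
  convert hG.compl

open Classical in
theorem adjMatrix_mul_self_apply [Fintype W] (x y : W) :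
    (G.adjMatrix ℚ * G.adjMatrix ℚ) x y = ((G.neighborSet x ∩ G.neighborSet y).ncard : ℚ) := by
  rw [Matrix.mul_apply, Set.ncard_eq_toFinset_card']
  simp only [SimpleGraph.adjMatrix_apply, ← ite_and, mul_ite, mul_one, mul_zero]
  rw [Finset.sum_boole]
  congr 2
  ext z
  simp [G.adj_comm z y, and_comm]

open Classical in
/-- A graph is strongly regular if and only if `A ^ 2 = k I + l A + m (J - I - A)` for its adjacency
matrix `A`. -/
theorem isSRG_iff_adjMatrix [Fintype W] {v k l m : ℕ} :
    IsSRG G v k l m ↔ Nat.card W = v ∧ G.adjMatrix ℚ * G.adjMatrix ℚ =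
      (k : ℚ) • (1 : Matrix W W ℚ) + (l : ℚ) • G.adjMatrix ℚ +
        (m : ℚ) • (Matrix.of (fun _ _ => 1) - 1 - G.adjMatrix ℚ) := by
  rw [isSRG_iff_ncard]
  refine and_congr_right fun _ => ?_
  rw [← Matrix.ext_iff]
  have hval : ∀ x y, ((k : ℚ) • (1 : Matrix W W ℚ) + (l : ℚ) • G.adjMatrix ℚ +
      (m : ℚ) • (Matrix.of (fun _ _ => 1) - 1 - G.adjMatrix ℚ) : Matrix W W ℚ) x y =
      if x = y then (k : ℚ) else if G.Adj x y then (l : ℚ) else m := by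
    intro x y
    simp only [Matrix.add_apply, Matrix.smul_apply, Matrix.sub_apply, Matrix.of_apply,
      Matrix.one_apply, SimpleGraph.adjMatrix_apply, smul_eq_mul]
    by_cases hxy : x = y
    · subst hxy; simp
    · by_cases ha : G.Adj x y <;> simp [hxy, ha]
  simp only [adjMatrix_mul_self_apply, hval]
  constructor
  · rintro ⟨h2, h3, h4⟩ x y
    split_ifs with hxy ha
    · subst hxy; rw [Set.inter_self, h2]
    · rw [h3 x y ha]
    · rw [h4 x y hxy ha]
  · intro hall
    refine ⟨fun x => ?_, fun x y ha => ?_, fun x y hxy ha => ?_⟩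
    · have := hall x x
      rw [Set.inter_self, if_pos rfl] at this
      exact_mod_cast this
    · have := hall x y
      rw [if_neg ha.ne, if_pos ha] at this
      exact_mod_cast this
    · have := hall x y
      rw [if_neg hxy, if_neg ha] at this
      exact_mod_cast this

/-- The equation of a strongly regular graph is preserved by conjugation with a symmetric involution
fixing the all-one matrix. -/
theorem srg_equation_conj [Fintype W] [DecidableEq W] {A Q J : Matrix W W ℚ} {k l m : ℚ}
    (hQ : Q * Q = 1) (hJ : Q * J * Q = J) (hA : A * A = k • 1 + l • A + m • (J - 1 - A)) :
    (Q * A * Q) * (Q * A * Q) = k • 1 + l • (Q * A * Q) + m • (J - 1 - Q * A * Q) := by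
  have h1 : (Q * A * Q) * (Q * A * Q) = Q * (A * A) * Q := by
    calc (Q * A * Q) * (Q * A * Q) = Q * A * (Q * Q) * A * Q := by simp only [mul_assoc]
      _ = Q * (A * A) * Q := by rw [hQ, mul_one, mul_assoc Q A A]
  rw [h1, hA]
  simp only [mul_add, add_mul, mul_sub, sub_mul, mul_smul_comm, smul_mul_assoc, mul_one, hQ, hJ]

open Classical in
/-- The vector `1` on `C₁`, `-1` on `C₂`, `0` elsewhere. -/
noncomputable def signVector (C₁ C₂ : Set W) (x : W) : ℚ :=
  if x ∈ C₁ then 1 else if x ∈ C₂ then -1 else 0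

open Classical in
theorem card_filter_mem_eq_ncard [Fintype W] (C : Set W) :
    ((Finset.univ.filter (· ∈ C)).card : ℚ) = (C.ncard : ℚ) := by
  rw [Set.ncard_eq_toFinset_card']
  congr 2
  ext; simp

open Classical in
theorem signVector_eq (hdisj : Disjoint C₁ C₂) (x : W) :
    signVector C₁ C₂ x = (if x ∈ C₁ then 1 else 0) - (if x ∈ C₂ then 1 else 0) := by
  rw [signVector]
  by_cases h1 : x ∈ C₁
  · simp [h1, Set.disjoint_left.1 hdisj h1]
  · by_cases h2 : x ∈ C₂ <;> simp [h1, h2]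

open Classical in
theorem adjMatrix_mulVec_signVector [Fintype W] (hdisj : Disjoint C₁ C₂) (x : W) :
    (G.adjMatrix ℚ).mulVec (signVector C₁ C₂) x =
      ((G.neighborSet x ∩ C₁).ncard : ℚ) - ((G.neighborSet x ∩ C₂).ncard : ℚ) := by
  rw [Matrix.mulVec, dotProduct]
  simp only [signVector_eq hdisj, SimpleGraph.adjMatrix_apply, mul_sub, Finset.sum_sub_distrib,
    mul_ite, mul_one, mul_zero, ← ite_and, Finset.sum_boole, Set.ncard_eq_toFinset_card']
  congr 3 <;> ext z <;> simp [and_comm]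

theorem dotProduct_signVector [Fintype W] (hdisj : Disjoint C₁ C₂) (hcard : C₁.ncard = C₂.ncard) :
    dotProduct (signVector C₁ C₂) (signVector C₁ C₂) = 2 * (C₁.ncard : ℚ) := by
  classical
  have : ∀ x, signVector C₁ C₂ x * signVector C₁ C₂ x =
      (if x ∈ C₁ then 1 else 0) + (if x ∈ C₂ then 1 else 0) := by
    intro x
    rw [signVector]
    by_cases h1 : x ∈ C₁
    · simp [h1, Set.disjoint_left.1 hdisj h1]
    · by_cases h2 : x ∈ C₂ <;> simp [h1, h2]
  rw [dotProduct, Finset.sum_congr rfl fun x _ => this x, Finset.sum_add_distrib,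
    Finset.sum_boole, Finset.sum_boole, card_filter_mem_eq_ncard, card_filter_mem_eq_ncard,
    ← hcard]
  ring

theorem sum_signVector [Fintype W] (hdisj : Disjoint C₁ C₂) (hcard : C₁.ncard = C₂.ncard) :
    ∑ x, signVector C₁ C₂ x = 0 := by
  classical
  rw [Finset.sum_congr rfl fun x _ => signVector_eq hdisj x, Finset.sum_sub_distrib,
    Finset.sum_boole, Finset.sum_boole, card_filter_mem_eq_ncard, card_filter_mem_eq_ncard,
    ← hcard, sub_self]

open Classical in
/-- Wang--Qiu--Hu switching conjugates the adjacency matrix by the reflection in the sign vector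
`d`, because `A d` is a multiple of `d` on `C₁ ∪ C₂` and takes the values `0`, `± |C₁|`
elsewhere. -/
theorem adjMatrix_switch_eq [Fintype W] (hsw : IsSwitchingSet G C₁ C₂) (hne : C₁.ncard ≠ 0) :
    let Q : Matrix W W ℚ := 1 - (C₁.ncard : ℚ)⁻¹ •
      Matrix.vecMulVec (signVector C₁ C₂) (signVector C₁ C₂)
    (switch G C₁ C₂).adjMatrix ℚ = Q * G.adjMatrix ℚ * Q := by
  intro Q
  obtain ⟨hdisj, hcard, ⟨k, hk₁, hk₂⟩, ⟨k', hk'⟩, hout⟩ := hsw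
  set s : ℚ := (C₁.ncard : ℚ) with hs
  have hs0 : s ≠ 0 := by rw [hs]; exact_mod_cast hne
  set d := signVector C₁ C₂ with hd
  set A := G.adjMatrix ℚ with hA
  set g := A.mulVec d with hg
  have hd₁ : ∀ x ∈ C₁, d x = 1 := fun x hx => by simp [hd, signVector, hx]
  have hd₂ : ∀ x ∈ C₂, d x = -1 := fun x hx => by
    simp [hd, signVector, hx, Set.disjoint_right.1 hdisj hx]
  have hd₀ : ∀ x ∉ C₁ ∪ C₂, d x = 0 := fun x hx => by
    rw [Set.mem_union, not_or] at hx
    simp [hd, signVector, hx.1, hx.2]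
  have hgx : ∀ x, g x = ((G.neighborSet x ∩ C₁).ncard : ℚ) - ((G.neighborSet x ∩ C₂).ncard : ℚ) :=
    adjMatrix_mulVec_signVector hdisj
  have hsplit : ∀ x, (G.neighborSet x ∩ (C₁ ∪ C₂)).ncard =
      (G.neighborSet x ∩ C₁).ncard + (G.neighborSet x ∩ C₂).ncard := by
    intro x
    rw [Set.inter_union_distrib_left, Set.ncard_union_eq
      (hdisj.mono Set.inter_subset_right Set.inter_subset_right)]
  obtain ⟨θ, hθ⟩ : ∃ θ : ℚ, ∀ x ∈ C₁ ∪ C₂, g x = θ * d x := by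
    refine ⟨2 * k - k', ?_⟩
    rintro x (hx | hx)
    · have h1 := hk' x (Or.inl hx)
      rw [hsplit, hk₁ x hx] at h1
      rw [hgx, hd₁ x hx, hk₁ x hx, ← h1]
      push_cast; ring
    · have h1 := hk' x (Or.inr hx)
      rw [hsplit, hk₂ x hx] at h1
      rw [hgx, hd₂ x hx, hk₂ x hx, ← h1]
      push_cast; ring
  have hdd : dotProduct d d = 2 * s := dotProduct_signVector hdisj hcard
  have hdg : dotProduct d g = θ * (2 * s) := by
    rw [← hdd, dotProduct, dotProduct, Finset.mul_sum]
    refine Finset.sum_congr rfl fun x _ => ?_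
    by_cases hx : x ∈ C₁ ∪ C₂
    · rw [hθ x hx]; ring
    · rw [hd₀ x hx]; ring
  have hvec : Matrix.vecMul d A = g := by
    rw [hg, ← Matrix.vecMul_transpose, hA, SimpleGraph.transpose_adjMatrix]
  have hQAQ : ∀ x y, (Q * A * Q) x y =
      A x y - s⁻¹ * (d x * g y + g x * d y) + s⁻¹ * s⁻¹ * (θ * (2 * s)) * (d x * d y) := by
    have : Q * A * Q = A - s⁻¹ • (Matrix.vecMulVec d g + Matrix.vecMulVec g d) +
        (s⁻¹ * s⁻¹ * (θ * (2 * s))) • Matrix.vecMulVec d d := by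
      have hQ : Q = 1 - s⁻¹ • Matrix.vecMulVec d d := rfl
      have hDA : Matrix.vecMulVec d d * A = Matrix.vecMulVec d g := by
        rw [Matrix.vecMulVec_mul, hvec]
      have hAD : A * Matrix.vecMulVec d d = Matrix.vecMulVec g d := by
        rw [Matrix.mul_vecMulVec]
      have hDAD : Matrix.vecMulVec d g * Matrix.vecMulVec d d =
          (θ * (2 * s)) • Matrix.vecMulVec d d := by
        rw [← hdg, Matrix.vecMulVec_mul_vecMulVec, Matrix.vecMulVec_smul, dotProduct_comm]
      rw [hQ, sub_mul, one_mul, smul_mul_assoc, hDA, mul_sub, mul_one, mul_smul_comm, sub_mul, hAD,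
        smul_mul_assoc, hDAD]
      module
    intro x y
    rw [this]
    simp only [Matrix.add_apply, Matrix.sub_apply, Matrix.smul_apply, Matrix.vecMulVec_apply,
      smul_eq_mul]
  have key : ∀ x ∉ C₁ ∪ C₂, ∀ y ∈ C₁ ∪ C₂,
      (switch G C₁ C₂).adjMatrix ℚ x y = A x y - s⁻¹ * (g x * d y) := by
    intro x hx y hy
    have hC : C₁ ≠ C₂ := by
      rintro rfl
      rw [disjoint_self, Set.bot_eq_empty] at hdisj
      rw [hdisj, Set.ncard_empty] at hne
      exact hne rfl
    have hAxy : A x y = if y ∈ G.neighborSet x ∩ (C₁ ∪ C₂) then 1 else 0 := by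
      rw [hA, SimpleGraph.adjMatrix_apply]
      simp only [Set.mem_inter_iff, SimpleGraph.mem_neighborSet, hy, and_true]
    have hsub : ∀ C, G.neighborSet x ∩ (C₁ ∪ C₂) = C → ∀ D, D ⊆ C₁ ∪ C₂ →
        G.neighborSet x ∩ D = C ∩ D := by
      rintro C rfl D hD
      rw [Set.inter_assoc, Set.inter_eq_right.2 hD]
    rw [SimpleGraph.adjMatrix_apply, hAxy]
    simp only [switch_adj_of_notMem_of_mem hx hy]
    by_cases h2 : G.neighborSet x ∩ (C₁ ∪ C₂) = C₂
    · have hgs : g x = -s := by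
        rw [hgx, hsub _ h2 C₁ Set.subset_union_left, hsub _ h2 C₂ Set.subset_union_right,
          hdisj.symm.inter_eq, Set.inter_self, Set.ncard_empty, ← hcard]
        push_cast; ring
      rw [switchedNeighbors_of_eq_right h2, hgs]
      simp only [h2]
      rcases hy with hy | hy
      · have := Set.disjoint_left.1 hdisj hy
        simp [hy, this, hd₁ y hy, hs0]
      · have := Set.disjoint_right.1 hdisj hy
        simp [hy, this, hd₂ y hy, hs0]
    by_cases h1 : G.neighborSet x ∩ (C₁ ∪ C₂) = C₁
    · have hgs : g x = s := by
        rw [hgx, hsub _ h1 C₁ Set.subset_union_left, hsub _ h1 C₂ Set.subset_union_right,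
          hdisj.inter_eq, Set.inter_self, Set.ncard_empty]
        push_cast; ring
      rw [switchedNeighbors_of_eq_left hC h1, hgs]
      simp only [h1]
      rcases hy with hy | hy
      · have := Set.disjoint_left.1 hdisj hy
        simp [hy, this, hd₁ y hy, hs0]
      · have := Set.disjoint_right.1 hdisj hy
        simp [hy, this, hd₂ y hy, hs0]
    · have h0 := ((hout x hx).resolve_right (not_or.2 ⟨h1, h2⟩))
      rw [switchedNeighbors_of_ne h1 h2, hgx, h0, sub_self, zero_mul, mul_zero, sub_zero]
      congr
  ext x y
  rw [hQAQ]
  by_cases hx : x ∈ C₁ ∪ C₂ <;> by_cases hy : y ∈ C₁ ∪ C₂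
  · rw [SimpleGraph.adjMatrix_apply, hA, SimpleGraph.adjMatrix_apply, hθ x hx, hθ y hy]
    simp only [switch_adj_of_mem hx hy]
    have : s⁻¹ * s⁻¹ * (θ * (2 * s)) = 2 * θ * s⁻¹ := by field_simp
    rw [this]
    ring
  · have hsymm : ∀ H : SimpleGraph W, H.adjMatrix ℚ x y = H.adjMatrix ℚ y x := fun H => by
      simp only [SimpleGraph.adjMatrix_apply, H.adj_comm]
    rw [hsymm, key y hy x hx, hd₀ y hy, hA, hsymm]
    ring
  · rw [key x hx y hy, hd₀ x hx]
    ring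
  · rw [SimpleGraph.adjMatrix_apply, hA, SimpleGraph.adjMatrix_apply, hd₀ x hx, hd₀ y hy]
    simp only [switch_adj_of_notMem hx hy]
    ring

open Classical in
theorem IsSwitchingSet.isSRG_switch [Finite W] (hsw : IsSwitchingSet G C₁ C₂) {v k l m : ℕ}
    (hG : IsSRG G v k l m) : IsSRG (switch G C₁ C₂) v k l m := by
  have := Fintype.ofFinite W
  by_cases hne : C₁.ncard = 0
  · have h2 : C₂ = ∅ := (Set.ncard_eq_zero C₂.toFinite).1 (hsw.card_eq ▸ hne)
    have h1 : C₁ = ∅ := (Set.ncard_eq_zero C₁.toFinite).1 hne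
    have : switch G C₁ C₂ = G := by
      ext x y
      exact switch_adj_of_notMem (by simp [h1, h2]) (by simp [h1, h2])
    rwa [this]
  · rw [isSRG_iff_adjMatrix] at hG ⊢
    refine ⟨hG.1, ?_⟩
    rw [adjMatrix_switch_eq hsw hne]
    set s : ℚ := (C₁.ncard : ℚ) with hs
    have hs0 : s ≠ 0 := by rw [hs]; exact_mod_cast hne
    set d := signVector C₁ C₂ with hd
    have hdd : dotProduct d d = 2 * s := dotProduct_signVector hsw.disjoint hsw.card_eq
    have hsum : ∑ x, d x = 0 := sum_signVector hsw.disjoint hsw.card_eq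
    refine srg_equation_conj ?_ ?_ hG.2
    · have hD : Matrix.vecMulVec d d * Matrix.vecMulVec d d =
          (2 * s) • Matrix.vecMulVec d d := by
        rw [← hdd, Matrix.vecMulVec_mul_vecMulVec, Matrix.vecMulVec_smul]
      rw [sub_mul, one_mul, smul_mul_assoc, mul_sub, mul_one, mul_smul_comm, hD, smul_smul,
        smul_sub, smul_smul]
      have : s⁻¹ * (s⁻¹ * (2 * s)) = 2 * s⁻¹ := by field_simp
      rw [this]
      module
    · have h1 : Matrix.vecMulVec d d * Matrix.of (fun _ _ : W => (1 : ℚ)) = 0 := by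
        ext x y
        simp [Matrix.mul_apply, Matrix.vecMulVec_apply, ← Finset.mul_sum, hsum]
      have h2 : Matrix.of (fun _ _ : W => (1 : ℚ)) * Matrix.vecMulVec d d = 0 := by
        ext x y
        simp [Matrix.mul_apply, Matrix.vecMulVec_apply, ← Finset.sum_mul, hsum]
      rw [sub_mul, one_mul, smul_mul_assoc, h1, smul_zero, sub_zero, mul_sub, mul_one,
        mul_smul_comm, h2, smul_zero, sub_zero]

end StronglyRegular

/-! ### The field of order four -/

section Quaternary

variable {K : Type*} [Field K] [Finite K] {σ : K →+* K}
  {V : Type*} [AddCommGroup V] [Module K V] [FiniteDimensional K V] {h : V →ₛₗ[σ] V →ₗ[K] K}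

/-- The right-hand side, six times the number of non-isotropic points of a nondegenerate space of
dimension `j` over the field of order `4`, is nonnegative and divisible by `6`. -/
theorem exists_six_mul_eq_pow_sub (j : ℕ) : ∃ g : ℕ, 6 * (g : ℤ) = 4 ^ j - (-1) ^ j * 2 ^ j := by
  obtain ⟨g, hg⟩ : ∃ g : ℤ, 6 * g = 4 ^ j - (-1) ^ j * 2 ^ j := by
    induction j with
    | zero => exact ⟨0, by simp⟩
    | succ j ih =>
      obtain ⟨g, hg⟩ := ih
      exact ⟨4 * g + (-1) ^ j * 2 ^ j, by
        rw [pow_succ, pow_succ, pow_succ]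
        linear_combination 4 * hg⟩
  have h1 : (0 : ℤ) ≤ 4 ^ j - (-1) ^ j * 2 ^ j := by
    have h4 : (4 : ℤ) ^ j = 2 ^ j * 2 ^ j := by rw [← mul_pow]; norm_num
    have h2 : (1 : ℤ) ≤ 2 ^ j := one_le_pow₀ (by norm_num)
    rcases neg_one_pow_eq_or ℤ j with he | he <;> rw [he, h4] <;> nlinarith
  exact ⟨g.toNat, by rw [Int.toNat_of_nonneg (by omega)]; exact hg⟩

/-- The number of non-isotropic points of a subspace over the field of order `4`, in terms of the
dimension `d` of its radical and the dimension `j` of the nondegenerate quotient. -/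
theorem ncard_pointsIn_four (hK : Nat.card K = 2 ^ 2) (hσ : ∀ a, σ a = a ^ 2) (hs : h.IsSymm)
    {d j g : ℕ} (hg : 6 * (g : ℤ) = 4 ^ j - (-1) ^ j * 2 ^ j) {U : Submodule K V}
    (hd : Module.finrank K (radical h U) = d) (hU : Module.finrank K U = d + j) :
    (pointsIn h U).ncard = 4 ^ d * g := by
  have h1 := ncard_pointsIn hK hσ hs hd hU
  have h2 := two_mul_isotropicCount_two j
  have h3 : 6 * ((pointsIn h U).ncard : ℤ) = 6 * ((4 ^ d * g : ℕ) : ℤ) := by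
    push_cast at h1 ⊢
    rw [pow_add] at h1
    linear_combination 2 * h1 - 4 ^ d * h2 - 4 ^ d * hg
  omega

/-- Over the field of order `4` the orthogonality graph is strongly regular: two distinct
nonadjacent points span a degenerate line, since all nonzero norms are `1`, so the perpendicular
space has a radical of dimension `1`. -/
theorem isSRG_graph_four (hK : Nat.card K = 2 ^ 2) (hσ : ∀ a, σ a = a ^ 2)
    (hh : IsNondegHermitian h) {j : ℕ} (hn : Module.finrank K V = j + 3) {v k l g : ℕ}
    (hv : 6 * (v : ℤ) = 4 ^ (j + 3) - (-1) ^ (j + 3) * 2 ^ (j + 3))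
    (hk : 6 * (k : ℤ) = 4 ^ (j + 2) - (-1) ^ (j + 2) * 2 ^ (j + 2))
    (hl : 6 * (l : ℤ) = 4 ^ (j + 1) - (-1) ^ (j + 1) * 2 ^ (j + 1))
    (hg : 6 * (g : ℤ) = 4 ^ j - (-1) ^ j * 2 ^ j) :
    IsSRG (graph h hh.1) v k l (4 * g) := by
  have hs := hh.1
  have htop := radical_top_eq_bot hh
  obtain ⟨β, hβ⟩ := exists_trace_eq_one hK hσ
  have hnbr : ∀ (x : V) (hx : h x x ≠ 0), (graph h hs).neighborSet (pointOf x hx) =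
      pointsIn h (⊤ ⊓ LinearMap.ker (h x)) := by
    intro x hx
    ext y
    rw [SimpleGraph.mem_neighborSet, adj_pointOf_iff_le_ker, top_inf_eq]
    rfl
  have hcom : ∀ (x y : V) (hx : h x x ≠ 0) (hy : h y y ≠ 0),
      (graph h hs).neighborSet (pointOf x hx) ∩ (graph h hs).neighborSet (pointOf y hy) =
        pointsIn h (⊤ ⊓ LinearMap.ker (h x) ⊓ LinearMap.ker (h y)) := by
    intro x y hx hy
    ext z
    rw [Set.mem_inter_iff, SimpleGraph.mem_neighborSet, SimpleGraph.mem_neighborSet,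
      adj_pointOf_iff_le_ker, adj_pointOf_iff_le_ker, top_inf_eq, ← le_inf_iff]
    rfl
  have hdim : ∀ x : V, h x x ≠ 0 →
      Module.finrank K (⊤ ⊓ LinearMap.ker (h x) : Submodule K V) = j + 2 := by
    intro x hx
    have := finrank_inf_ker (φ := h x) (Submodule.mem_top (x := x)) hx
    rw [finrank_top] at this
    omega
  have hrad : ∀ x : V, h x x ≠ 0 → radical h (⊤ ⊓ LinearMap.ker (h x)) = ⊥ := fun x hx =>
    (radical_inf_ker hs Submodule.mem_top hx).trans htop
  rw [isSRG_iff_ncard]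
  refine ⟨?_, fun x => ?_, fun x y hxy => ?_, fun x y hne hxy => ?_⟩
  · have h1 := ncard_pointsIn_four hK hσ hs hv (d := 0) (U := ⊤) (by rw [htop, finrank_bot])
      (by rw [finrank_top]; omega)
    have h2 : pointsIn h ⊤ = Set.univ := Set.eq_univ_of_forall fun x => le_top (a := x.1.submodule)
    rw [h2, Set.ncard_univ] at h1
    rw [h1, pow_zero, one_mul]
  · obtain ⟨x, hx, rfl⟩ := exists_eq_pointOf x
    rw [hnbr, ncard_pointsIn_four hK hσ hs hk (d := 0) (by rw [hrad x hx, finrank_bot])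
      (by rw [hdim x hx]; omega), pow_zero, one_mul]
  · obtain ⟨x, hx, rfl⟩ := exists_eq_pointOf x
    obtain ⟨y, hy, rfl⟩ := exists_eq_pointOf y
    rw [adj_pointOf_iff] at hxy
    have hyU : y ∈ ⊤ ⊓ LinearMap.ker (h x) := mem_inf_ker.2 ⟨trivial, hxy⟩
    have h1 := finrank_inf_ker hyU hy
    rw [hdim x hx] at h1
    rw [hcom, ncard_pointsIn_four hK hσ hs hl (d := 0)
      (by rw [radical_inf_ker hs hyU hy, hrad x hx, finrank_bot]) (by omega), pow_zero, one_mul]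
  · obtain ⟨x, hx, rfl⟩ := exists_eq_pointOf x
    obtain ⟨y, hy, rfl⟩ := exists_eq_pointOf y
    rw [adj_pointOf_iff] at hxy
    -- Elements of the field of order `4` fixed by `σ` lie in the field of order `2`.
    have hone : ∀ a : K, a ≠ 0 → σ a = a → a = 1 := fun a ha haa => by
      rw [hσ, pow_two] at haa
      exact mul_right_cancel₀ ha (haa.trans (one_mul a).symm)
    have hxx : h x x = 1 := hone _ hx (conj_self hs x)
    have hyy : h y y = 1 := hone _ hy (conj_self hs y)
    have hnorm : h x y * h y x = 1 := by
      refine hone _ (mul_ne_zero hxy fun h0 => hxy (hs.isRefl _ _ h0)) ?_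
      rw [map_mul, hs.eq, hs.eq, mul_comm]
    -- The radical of the line through `x` and `y`.
    obtain ⟨e, he⟩ : ∃ e, e = y - h x y • x := ⟨_, rfl⟩
    have hxe : h x e = 0 := by rw [he, map_sub, map_smul, hxx, smul_eq_mul, mul_one, sub_self]
    have hye : h y e = 0 := by
      rw [he, map_sub, map_smul, hyy, smul_eq_mul, hnorm, sub_self]
    have hee : h e e = 0 := by
      have : h e e = h (y - h x y • x) e := by rw [← he]
      rw [this, map_sub, map_smulₛₗ, LinearMap.sub_apply, LinearMap.smul_apply, hxe, hye,
        smul_zero, sub_zero]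
    have he0 : e ≠ 0 := by
      intro h0
      rw [h0] at he
      exact hne ((pointOf_eq_iff hy hx).2 ⟨_, (sub_eq_zero.1 he.symm).symm⟩).symm
    -- Replacing `y` by `e` does not change the perpendicular space.
    have hker : ⊤ ⊓ LinearMap.ker (h x) ⊓ LinearMap.ker (h y) =
        ⊤ ⊓ LinearMap.ker (h x) ⊓ LinearMap.ker (h e) := by
      ext z
      rw [mem_inf_ker, mem_inf_ker (u := e)]
      refine and_congr_right fun hz => ?_
      rw [he, map_sub, map_smulₛₗ, LinearMap.sub_apply, LinearMap.smul_apply,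
        (mem_inf_ker.1 hz).2, smul_zero, sub_zero]
    have heU : e ∈ ⊤ ⊓ LinearMap.ker (h x) := mem_inf_ker.2 ⟨trivial, hxe⟩
    obtain ⟨f, hf, -, hef⟩ := exists_hyperbolic_partner hs hβ (hrad x hx) heU he0 hee
    have h1 := finrank_inf_ker (φ := h e) hf (by rw [hef]; exact one_ne_zero)
    rw [hdim x hx] at h1
    rw [hcom, hker, ncard_pointsIn_four hK hσ hs hg (d := 1)
      (by rw [radical_inf_ker_isotropic hs (conj_conj hK hσ) (hrad x hx) heU he0 hee,
        finrank_span_singleton he0]) (by omega), pow_one]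

/-- The strongly regular parameters of the orthogonality graph, of its complement, and of any graph
obtained from it by switching. -/
theorem exists_isSRG_four (hK : Nat.card K = 2 ^ 2) (hσ : ∀ a, σ a = a ^ 2)
    (hh : IsNondegHermitian h) (n : ℕ) (hn : Module.finrank K V = n) (hn6 : 6 ≤ n)
    {C₁ C₂ : Set (NonIsotropicPoint h)} (hsw : IsSwitchingSet (graph h hh.1) C₁ C₂) :
    (∃ v k l m : ℕ, IsSRG (graph h hh.1) v k l m ∧
      IsSRG (switch (graph h hh.1) C₁ C₂) v k l m) ∧
    ∃ v k l m : ℕ,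
      3 * (v : ℤ) = 2 ^ (n - 1) * (2 ^ n - (-1) ^ n) ∧
      (k : ℤ) = (2 ^ (n - 1) + (-1) ^ n) * (2 ^ (n - 2) - (-1) ^ n) ∧
      (l : ℤ) = 3 * 2 ^ (2 * n - 5) - (-1) ^ n * 2 ^ (n - 2) - 2 ∧
      (m : ℤ) = 3 * 2 ^ (n - 3) * (2 ^ (n - 2) - (-1) ^ n) ∧
      IsSRG (graph h hh.1)ᶜ v k l m ∧ IsSRG (switch (graph h hh.1) C₁ C₂)ᶜ v k l m := by
  obtain ⟨i, rfl⟩ : ∃ i, n = i + 6 := ⟨n - 6, by omega⟩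
  obtain ⟨v, hv⟩ := exists_six_mul_eq_pow_sub (i + 3 + 3)
  obtain ⟨k, hk⟩ := exists_six_mul_eq_pow_sub (i + 3 + 2)
  obtain ⟨l, hl⟩ := exists_six_mul_eq_pow_sub (i + 3 + 1)
  obtain ⟨g, hg⟩ := exists_six_mul_eq_pow_sub (i + 3)
  have hG := isSRG_graph_four hK hσ hh hn hv hk hl hg
  have hS := hsw.isSRG_switch hG
  refine ⟨⟨_, _, _, _, hG, hS⟩, _, _, _, _, ?_, ?_, ?_, ?_, hG.compl, hS.compl⟩ <;> clear hG hS
  all_goals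
    -- With `X = 2 ^ i`, `Y = X ^ 2` and a fixed sign `(-1) ^ i`, all is linear in `X` and `Y`.
    -- The bounds `1 ≤ X ≤ Y` keep the natural subtractions in the complement from truncating.
    have e1 : i + 6 - 1 = i + 5 := by omega
    have e2 : i + 6 - 2 = i + 4 := by omega
    have e3 : i + 6 - 3 = i + 3 := by omega
    have e4 : 2 * (i + 6) - 5 = i + i + 7 := by omega
    have h4 : (4 : ℤ) ^ i = 2 ^ i * 2 ^ i := by rw [← mul_pow]; norm_num
    have hX : (1 : ℤ) ≤ 2 ^ i := one_le_pow₀ (by norm_num)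
    have hY : (2 : ℤ) ^ i ≤ 2 ^ i * 2 ^ i := by nlinarith
    simp only [e1, e2, e3, e4, pow_add, h4] at hv hk hl hg ⊢
    generalize (2 : ℤ) ^ i = X at *
    generalize hXY : X * X = Y at *
    have p₁ : X * 32 * (X * 64 - 1) = 2048 * Y - 32 * X := by linear_combination 2048 * hXY
    have p₂ : X * 32 * (X * 64 + 1) = 2048 * Y + 32 * X := by linear_combination 2048 * hXY
    have p₃ : (X * 32 + 1) * (X * 16 - 1) = 512 * Y - 16 * X - 1 := by
      linear_combination 512 * hXY
    have p₄ : (X * 32 + -1) * (X * 16 + 1) = 512 * Y + 16 * X - 1 := by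
      linear_combination 512 * hXY
    have p₅ : 3 * (X * 8) * (X * 16 - 1) = 384 * Y - 24 * X := by linear_combination 384 * hXY
    have p₆ : 3 * (X * 8) * (X * 16 + 1) = 384 * Y + 24 * X := by linear_combination 384 * hXY
    clear hXY
    rcases neg_one_pow_eq_or ℤ i with he | he <;> rw [he] at hv hk hl hg ⊢ <;>
      norm_num at hv hk hl hg ⊢ <;> (try simp only [p₁, p₂, p₃, p₄, p₅, p₆]) <;> omega

end Quaternary

end PolarityGraph

open PolarityGraph in
theorem theorem9 {K : Type*} [Field K] [Finite K] (r : ℕ) (hK : Nat.card K = r ^ 2)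
    (σ : K →+* K) (hσ : ∀ a, σ a = a ^ r)
    {V : Type*} [AddCommGroup V] [Module K V] [FiniteDimensional K V]
    (n : ℕ) (hn : Module.finrank K V = n) (hn6 : 6 ≤ n)
    (h : V →ₛₗ[σ] V →ₗ[K] K) (hh : IsNondegHermitian h) :
    -- the number of common neighbours of a triangle of `Γ` is constant
    (∃ N : ℕ, ∀ x y z : NonIsotropicPoint h, IsTriangle (graph h hh.1) x y z →
      (commonNeighbors₃ (graph h hh.1) x y z).ncard = N) ∧
    -- suitable `L₁`, `L₂` exist
    (∃ L₁ L₂ : Submodule K V, IsSwitchingPair h 3 L₁ L₂ ∧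
      IsUnitaryQuotient h (L₁ ⊔ L₂) (L₁ ⊓ L₂) 2) ∧
    -- for all of them, the switched graph has the asserted properties
    (∀ L₁ L₂ : Submodule K V, IsSwitchingPair h 3 L₁ L₂ →
      IsUnitaryQuotient h (L₁ ⊔ L₂) (L₁ ⊓ L₂) 2 →
      IsSwitchingSet (graph h hh.1) (pointsDiff h L₁ L₂) (pointsDiff h L₂ L₁) ∧
      (∃ x y z : NonIsotropicPoint h,
        ¬ x.1.submodule ≤ L₁ ⊔ L₂ ∧ ¬ y.1.submodule ≤ L₁ ⊔ L₂ ∧ ¬ z.1.submodule ≤ L₁ ⊔ L₂ ∧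
        IsTriangle (graph h hh.1) x y z ∧ IsTriangle (switchedGraph h hh.1 L₁ L₂) x y z ∧
        (commonNeighbors₃ (switchedGraph h hh.1 L₁ L₂) x y z).ncard + 1 =
          (commonNeighbors₃ (graph h hh.1) x y z).ncard) ∧
      ¬ Nonempty (switchedGraph h hh.1 L₁ L₂ ≃g graph h hh.1) ∧
      (Nat.card K = 4 →
        (∃ v k l m : ℕ, IsSRG (graph h hh.1) v k l m ∧
          IsSRG (switchedGraph h hh.1 L₁ L₂) v k l m) ∧
        ∃ v k l m : ℕ,
          3 * (v : ℤ) = 2 ^ (n - 1) * (2 ^ n - (-1) ^ n) ∧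
          (k : ℤ) = (2 ^ (n - 1) + (-1) ^ n) * (2 ^ (n - 2) - (-1) ^ n) ∧
          (l : ℤ) = 3 * 2 ^ (2 * n - 5) - (-1) ^ n * 2 ^ (n - 2) - 2 ∧
          (m : ℤ) = 3 * 2 ^ (n - 3) * (2 ^ (n - 2) - (-1) ^ n) ∧
          IsSRG (graph h hh.1)ᶜ v k l m ∧ IsSRG (switchedGraph h hh.1 L₁ L₂)ᶜ v k l m)) := by
  have hs := hh.1
  refine ⟨exists_ncard_commonNeighbors₃_eq hK hσ hh (by omega), ?_, ?_⟩
  · obtain ⟨e, u, w, hf⟩ := exists_isSwitchingFrame_of_finrank hK hσ hh (by omega)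
    exact ⟨_, _, hf.isSwitchingPair hs, hf.isUnitaryQuotient hs⟩
  · intro L₁ L₂ hp hq
    obtain ⟨e, u, w, hf, rfl, rfl⟩ := exists_isSwitchingFrame hs hp hq
    have hsw := hf.isSwitchingSet hs
    have htri := hf.exists_triangle hK hσ hh (by omega)
    refine ⟨hsw, htri, ?_, fun h4 => ?_⟩
    · -- An isomorphism would map the triangle to one with the constant number of common neighbours.
      rintro ⟨φ⟩
      obtain ⟨N, hN⟩ := exists_ncard_commonNeighbors₃_eq hK hσ hh (by omega)
      obtain ⟨x, y, z, -, -, -, h1, h2, h3⟩ := htri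
      rw [hN x y z h1, ← ncard_commonNeighbors₃_iso φ x y z,
        hN _ _ _ ((isTriangle_iso φ).2 h2)] at h3
      omega
    · have hr : r = 2 := by
        have := two_le_of_card hK
        nlinarith
      subst hr
      exact exists_isSRG_four hK hσ hh n hn hn6 hsw
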